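/- **Setting.** Let $A\in\mathbb R^{d_x\times d_x}$, $B\in\mathbb R^{d_x\times d_u}$, $d=\max(d_x,d_u)$, and consider the system $x_{t+1}=Ax_t+Bu_t+w_t$, $x_1=0$, where $w_1,w_2,\dots$ are i.i.d. with a law $\mathcal D_w$ such that $\mathbb E[w_t]=0$, $\|w_t\|\le W$ almost surely and $\mathbb E[w_tw_t^\top]\succeq\sigma^2I$ with $\sigma>0$; put $w_s=0$ for $s<1$. Matrix norms are spectral norms. Let $\kappa\ge1$, $0<\gamma<1$. A matrix $K\in\mathbb R^{d_u\times d_x}$ is *$(\kappa,\gamma)$-diagonal strongly stable* if $A-BK=QLQ^{-1}$ for a complex diagonal matrix $L$ and an invertible complex matrix $Q$ with $\|L\|\le1-\gamma$ and $\|K\|,\|Q\|,\|Q^{-1}\|\le\kappa$. Let $\mathcal K$ be the set of these $K$, let $\mathbb K\in\mathcal K$ be fixed, and let $\kappa_B$ satisfy $\|B\|\le\kappa_B$ and $\kappa_B(1-\gamma)\ge2$. For a horizon $T\ge2$ put $H=\lceil\gamma^{-1}\log(T\kappa^2)\rceil$ and $$\mathcal M=\{M=(M^{[0]},\dots,M^{[H-1]}):\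 M^{[i-1]}\in\mathbb R^{d_u\times d_x},\ \|M^{[i-1]}\|\le\kappa^3\kappa_B(1-\gamma)^i,\ 1\le i\le H\}.$$ **Costs.** $c_t(x,u)=r_t(\|x\|^2+\|u\|^2)$, where $(r_t)$ is any sequence of numbers in $[\alpha,\beta]$, $\alpha>0$. For a control rule $\mathcal A$, $J_T(\mathcal A)=\mathbb E\sum_{t=1}^Tc_t(x_t,u_t)$; $J_T(K)$ is the cost of $u_t=-Kx_t$. **Algorithm (online natural gradient).** With $\tilde A=A-B\mathbb K$, i.i.d. $n_0,\dots,n_{2H}\sim\mathcal D_w$ and $$\Psi_i(M)=\tilde A^i\mathbf 1_{i\le H}+\sum_{j=0}^H\tilde A^jBM^{[i-j-1]}\mathbf 1_{1\le i-j\le H},$$ let $y(M)=\sum_{i=0}^{2H}\Psi_i(M)n_i$, $v(M)=-\mathbb Ky(M)+\sum_{i=1}^HM^{[i-1]}n_{i-1}$ and $f_t(M)=\mathbb E[c_t(y(M),v(M))]$. Let $J$ be the (random) Jacobian of the affine map $M_{\rm vec}\mapsto(y(M),v(M))$, where $M_{\rm vec}$ is the vector of all entries of $M$, and $P=\mathbb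 E[J^\top J]$. Starting from an arbitrary $M_1\in\mathcal M$, the algorithm plays $u_t=-\mathbb Kx_t+\sum_{i=1}^HM_t^{[i-1]}w_{t-i}$ and updates $$M_{t+1}=\Pi_{\mathcal M}\bigl(M_t-\eta_tP^{-1}\nabla f_t(M_t)\bigr),$$ where $\Pi_{\mathcal M}$ is the projection onto $\mathcal M$ in the norm $\|V\|_P=(V^\top PV)^{1/2}$, and the step sizes satisfy $\frac1{\alpha t}\le\eta_t\le\frac c{\alpha t}$ for a constant $c\ge1$. **Claim.** For every $c\ge1$ there are constants $C,p$, depending only on $c$, such that in every such setting $\min_{K\in\mathcal K}J_T(K)$ is attained and $$J_T(\mathcal A)-\min_{K\in\mathcal K}J_T(K)\ \le\ C\,\bigl(d\,\kappa\,\kappa_B\,\gamma^{-1}\bigr)^p\;\frac{\beta^2W^2}{\alpha}\;\log^7T .$$ In particular the bound does not depend on $\sigma$. -/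

import Mathlib

open MeasureTheory ProbabilityTheory
open scoped Matrix Matrix.Norms.L2Operator Gradient

noncomputable section

namespace OnlineControl

/-- Euclidean space `ℝⁿ`. -/
abbrev Vec (n : ℕ) := EuclideanSpace ℝ (Fin n)

/-- The matrix `A` applied to a vector of Euclidean space. -/
def app {m n : ℕ} (A : Matrix (Fin m) (Fin n) ℝ) (x : Vec n) : Vec m :=
  Matrix.toEuclideanLin A x

/-! ### The linear dynamical system and linear controllers -/

/-- `K` is `(κ, γ)`-diagonal strongly stable for `(A, B)`. All matrix norms are spectral norms
(operator norms for the Euclidean norm). -/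
def DiagStronglyStable {dx du : ℕ} (A : Matrix (Fin dx) (Fin dx) ℝ)
    (B : Matrix (Fin dx) (Fin du) ℝ) (κ γ : ℝ) (K : Matrix (Fin du) (Fin dx) ℝ) : Prop :=
  ∃ (l : Fin dx → ℂ) (Q : Matrix (Fin dx) (Fin dx) ℂ), IsUnit Q.det ∧
    (A - B * K).map Complex.ofReal = Q * Matrix.diagonal l * Q⁻¹ ∧
    ‖Matrix.diagonal l‖ ≤ 1 - γ ∧ ‖K‖ ≤ κ ∧ ‖Q‖ ≤ κ ∧ ‖Q⁻¹‖ ≤ κ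

/-- The state `x_t` (`t ≥ 1`) of `x_{t+1} = A x_t + B u_t + w_t`, `x_1 = 0`, when the action at
time `t` in state `x` is `u_t = ctrl t x`. The value at `t = 0` is a placeholder. -/
def state {dx du : ℕ} (A : Matrix (Fin dx) (Fin dx) ℝ) (B : Matrix (Fin dx) (Fin du) ℝ)
    (ctrl : ℕ → Vec dx → Vec du) (w : ℕ → Vec dx) : ℕ → Vec dx
  | 0 => 0
  | 1 => 0
  | t + 2 => app A (state A B ctrl w (t + 1))
      + app B (ctrl (t + 1) (state A B ctrl w (t + 1))) + w (t + 1)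

/-- The expected total cost `E[∑_{t=1}^T c_t(x_t, u_t)]`. The controller may depend on the
realized noise sequence (its first argument). -/
def expectedCost {Ω : Type*} [MeasurableSpace Ω] (P : Measure Ω) {dx du : ℕ}
    (A : Matrix (Fin dx) (Fin dx) ℝ) (B : Matrix (Fin dx) (Fin du) ℝ)
    (w : ℕ → Ω → Vec dx) (c : ℕ → Vec dx → Vec du → ℝ) (T : ℕ)
    (ctrl : (ℕ → Vec dx) → ℕ → Vec dx → Vec du) : ℝ :=
  ∫ ω, ∑ t ∈ Finset.Icc 1 T,
    c t (state A B (ctrl fun s => w s ω) (fun s => w s ω) t)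
      (ctrl (fun s => w s ω) t (state A B (ctrl fun s => w s ω) (fun s => w s ω) t)) ∂P

/-- The linear controller `u_t = -K x_t`. -/
def linearCtrl {dx du : ℕ} (K : Matrix (Fin du) (Fin dx) ℝ) :
    (ℕ → Vec dx) → ℕ → Vec dx → Vec du :=
  fun _ _ x => -app K x

/-! ### Disturbance-action policies -/

/-- A policy `M = (M^{[0]}, …, M^{[H-1]})`, flattened to the vector `M_vec` of its entries, with
the Euclidean structure. The coordinate `(i, a, b)` is the entry `(a, b)` of `M^{[i]}`. -/
abbrev Policy (H dx du : ℕ) := EuclideanSpace ℝ (Fin H × Fin du × Fin dx)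

/-- The matrix `M^{[i]}`, extended by `0` to `i ≥ H`. -/
def block {H dx du : ℕ} (M : Policy H dx du) (i : ℕ) : Matrix (Fin du) (Fin dx) ℝ :=
  if h : i < H then Matrix.of fun a b => M (⟨i, h⟩, a, b) else 0

/-- The set `{M : ‖M^{[i-1]}‖ ≤ κ³ κ_B (1-γ)^i, i = 1, …, H}`. -/
def policySet (H dx du : ℕ) (κ κB γ : ℝ) : Set (Policy H dx du) :=
  {M | ∀ i ∈ Finset.Icc 1 H, ‖block M (i - 1)‖ ≤ κ ^ 3 * κB * (1 - γ) ^ i}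

/-- The controller `u_t = -K₀ x_t + ∑_{i=1}^H M_t^{[i-1]} w_{t-i}`, where `w_s = 0` for `s < 1`. -/
def policyCtrl {H dx du : ℕ} (K₀ : Matrix (Fin du) (Fin dx) ℝ) (M : ℕ → Policy H dx du) :
    (ℕ → Vec dx) → ℕ → Vec dx → Vec du :=
  fun w t x => -app K₀ x +
    ∑ i ∈ Finset.Icc 1 H, if i < t then app (block (M t) (i - 1)) (w (t - i)) else 0

/-! ### Surrogate state, action and cost -/

/-- The transfer matrix `Ψ_i(M) = Ã^i 1_{i ≤ H} + ∑_{j=0}^H Ã^j B M^{[i-j-1]} 1_{1 ≤ i-j ≤ H}`,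
`Ã = A - B K₀`, of a policy `M` that is used at all times. -/
def transfer {H dx du : ℕ} (A : Matrix (Fin dx) (Fin dx) ℝ) (B : Matrix (Fin dx) (Fin du) ℝ)
    (K₀ : Matrix (Fin du) (Fin dx) ℝ) (M : Policy H dx du) (i : ℕ) :
    Matrix (Fin dx) (Fin dx) ℝ :=
  (if i ≤ H then (A - B * K₀) ^ i else 0) +
    ∑ j ∈ Finset.range (H + 1),
      if j + 1 ≤ i ∧ i ≤ j + H then (A - B * K₀) ^ j * B * block M (i - j - 1) else 0

/-- The surrogate state `y(M) = ∑_{i=0}^{2H} Ψ_i(M) n_i`; `n_i` is the noise of age `i`, that is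
the noise `i + 1` steps before the time of the surrogate state. -/
def surrogateState {H dx du : ℕ} (A : Matrix (Fin dx) (Fin dx) ℝ)
    (B : Matrix (Fin dx) (Fin du) ℝ) (K₀ : Matrix (Fin du) (Fin dx) ℝ) (M : Policy H dx du)
    (n : Fin (2 * H + 1) → Vec dx) : Vec dx :=
  ∑ i : Fin (2 * H + 1), app (transfer A B K₀ M i) (n i)

/-- The surrogate action `v(M) = -K₀ y(M) + ∑_{i=1}^H M^{[i-1]} n_{i-1}`. -/
def surrogateAction {H dx du : ℕ} (A : Matrix (Fin dx) (Fin dx) ℝ)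
    (B : Matrix (Fin dx) (Fin du) ℝ) (K₀ : Matrix (Fin du) (Fin dx) ℝ) (M : Policy H dx du)
    (n : Fin (2 * H + 1) → Vec dx) : Vec du :=
  -app K₀ (surrogateState A B K₀ M n) +
    ∑ i : Fin H, app (block M i) (n ⟨i, by omega⟩)

/-- The surrogate cost `f(M) = E[c(y(M), v(M))]`, with independent noises of law `D`. -/
def surrogateCost {H dx du : ℕ} (A : Matrix (Fin dx) (Fin dx) ℝ)
    (B : Matrix (Fin dx) (Fin du) ℝ) (K₀ : Matrix (Fin du) (Fin dx) ℝ) (D : Measure (Vec dx))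
    (c : Vec dx → Vec du → ℝ) (M : Policy H dx du) : ℝ :=
  ∫ n, c (surrogateState A B K₀ M n) (surrogateAction A B K₀ M n)
    ∂(Measure.pi fun _ : Fin (2 * H + 1) => D)

/-- The stacked vector `z(M) = (y(M), v(M))`. -/
def surrogatePair {H dx du : ℕ} (A : Matrix (Fin dx) (Fin dx) ℝ)
    (B : Matrix (Fin dx) (Fin du) ℝ) (K₀ : Matrix (Fin du) (Fin dx) ℝ) (M : Policy H dx du)
    (n : Fin (2 * H + 1) → Vec dx) : Fin dx ⊕ Fin du → ℝ :=
  Sum.elim (fun a => surrogateState A B K₀ M n a) (fun a => surrogateAction A B K₀ M n a)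

/-- The Jacobian `J` of `M_vec ↦ z(M)`. As `z` is affine in `M`, its column at the coordinate `p`
is `z(e_p) - z(0)`. -/
def jacobian {H dx du : ℕ} (A : Matrix (Fin dx) (Fin dx) ℝ)
    (B : Matrix (Fin dx) (Fin du) ℝ) (K₀ : Matrix (Fin du) (Fin dx) ℝ)
    (n : Fin (2 * H + 1) → Vec dx) :
    Matrix (Fin dx ⊕ Fin du) (Fin H × Fin du × Fin dx) ℝ :=
  Matrix.of fun ρ p => surrogatePair A B K₀ (EuclideanSpace.single p 1 : Policy H dx du) n ρ
    - surrogatePair A B K₀ (0 : Policy H dx du) n ρ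

/-- The preconditioner `E[Jᵀ J]`. -/
def gram (H : ℕ) {dx du : ℕ} (A : Matrix (Fin dx) (Fin dx) ℝ)
    (B : Matrix (Fin dx) (Fin du) ℝ) (K₀ : Matrix (Fin du) (Fin dx) ℝ) (D : Measure (Vec dx)) :
    Matrix (Fin H × Fin du × Fin dx) (Fin H × Fin du × Fin dx) ℝ :=
  Matrix.of fun p q => ∫ n, ((jacobian A B K₀ n)ᵀ * jacobian A B K₀ n) p q
    ∂(Measure.pi fun _ : Fin (2 * H + 1) => D)

/-! ### The online natural gradient update -/

/-- The squared matrix norm `‖V‖_U² = Vᵀ U V`. -/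
def sqNorm {ι : Type*} [Fintype ι] (U : Matrix ι ι ℝ) (V : EuclideanSpace ℝ ι) : ℝ :=
  V.ofLp ⬝ᵥ (U *ᵥ V.ofLp)

/-- `N` is a projection of `V` onto the set `S` in the norm `‖·‖_U`. -/
def IsProjection {ι : Type*} [Fintype ι] (U : Matrix ι ι ℝ) (S : Set (EuclideanSpace ℝ ι))
    (V N : EuclideanSpace ℝ ι) : Prop :=
  N ∈ S ∧ ∀ N' ∈ S, sqNorm U (N - V) ≤ sqNorm U (N' - V)

/-- `M_1, …, M_T` are iterates of the online natural gradient update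
`M_{t+1} = Π(M_t - η_t E[JᵀJ]⁻¹ ∇f_t(M_t))` with an arbitrary initial policy `M_1` in the policy
set, `f_t` being the surrogate cost of `c_t`. -/
def IsNaturalGradientRun {H dx du : ℕ} (A : Matrix (Fin dx) (Fin dx) ℝ)
    (B : Matrix (Fin dx) (Fin du) ℝ) (K₀ : Matrix (Fin du) (Fin dx) ℝ) (κ κB γ : ℝ)
    (D : Measure (Vec dx)) (c : ℕ → Vec dx → Vec du → ℝ) (η : ℕ → ℝ) (T : ℕ)
    (M : ℕ → Policy H dx du) : Prop :=
  M 1 ∈ policySet H dx du κ κB γ ∧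
  ∀ t, 1 ≤ t → t < T →
    IsProjection (gram H A B K₀ D) (policySet H dx du κ κB γ)
      (M t - η t • Matrix.toEuclideanLin (gram H A B K₀ D)⁻¹
        (∇ (surrogateCost A B K₀ D (c t)) (M t)))
      (M (t + 1))

/-- The horizon `H = γ⁻¹ log(T κ²)`, rounded up to an integer. -/
def horizon (κ γ : ℝ) (T : ℕ) : ℕ := ⌈γ⁻¹ * Real.log (T * κ ^ 2)⌉₊

/-! ### The noise and the costs -/

/-- A noise law that is bounded by `W`, centred, and has `E[w wᵀ] ⪰ σ² I`. -/
structure NoiseLaw {dx : ℕ} (D : Measure (Vec dx)) (W σ : ℝ) : Prop where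
  bounded : ∀ᵐ x ∂D, ‖x‖ ≤ W
  centred : ∫ x, x ∂D = 0
  covariance : ((Matrix.of fun a b => ∫ x, x a * x b ∂D : Matrix (Fin dx) (Fin dx) ℝ)
    - σ ^ 2 • (1 : Matrix (Fin dx) (Fin dx) ℝ)).PosSemidef

/-- The costs `c_t(x, u) = r_t (‖x‖² + ‖u‖²)`. -/
def sphericalCost {dx du : ℕ} (r : ℕ → ℝ) : ℕ → Vec dx → Vec du → ℝ :=
  fun t x u => r t * (‖x‖ ^ 2 + ‖u‖ ^ 2)

end OnlineControl

end

open OnlineControl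

/-!
Relative to the stabilising feedback `K₀`, every controller in sight is determined by the action
it adds to `-K₀ x`, and strong stability makes state and action Lipschitz in these added actions.
A linear controller `K` adds `(K₀ - K) (A - B K)^i w_{t-1-i}` summed over the past, which a
disturbance-action policy of memory `H` reproduces up to an error of order `(1 - γ)^H ≤ 1 / T`.
For a constant policy the state also forgets all but the last `2H + 1` noises up to such an error,
so the cost at time `t > 2H + 1` is nearly the surrogate cost `r_t E‖z(M)‖²`.

All surrogate costs are multiples of the same quadratic `c₁ + ‖M - m‖_P²` with `P = E[JᵀJ]`, so the
preconditioned gradient step is `M_t - s_t (M_t - m)` with `s_t = 2 r_t η_t ≥ 2 / t`, and once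
`s_t ≤ 1` the `P`-distance `E_t` of `M_t` to the constrained minimiser contracts by `1 - 2 / t`.
Hence `E_t = O(1 / t²)` and `∑ E_t` is bounded. Finally, at time `t > 2H + 1` the history of
noises has the law used in `P`, so `E_t` bounds the mean difference of the added actions of `M_t`
and of the minimiser; no lower bound on `P`, hence no `σ`, enters.
-/

namespace OnlineControl

noncomputable section

section Application

variable {l m n : ℕ}

lemma app_ofLp (A : Matrix (Fin m) (Fin n) ℝ) (x : Vec n) : (app A x).ofLp = A *ᵥ x.ofLp := rfl

lemma app_add (A : Matrix (Fin m) (Fin n) ℝ) (x y : Vec n) : app A (x + y) = app A x + app A y :=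
  map_add _ _ _

lemma app_sub (A : Matrix (Fin m) (Fin n) ℝ) (x y : Vec n) : app A (x - y) = app A x - app A y :=
  map_sub _ _ _

lemma app_smul (A : Matrix (Fin m) (Fin n) ℝ) (a : ℝ) (x : Vec n) :
    app A (a • x) = a • app A x :=
  map_smul _ _ _

lemma app_zero (A : Matrix (Fin m) (Fin n) ℝ) : app A 0 = 0 := map_zero _

lemma app_sum {ι : Type*} (A : Matrix (Fin m) (Fin n) ℝ) (s : Finset ι) (x : ι → Vec n) :
    app A (∑ i ∈ s, x i) = ∑ i ∈ s, app A (x i) :=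
  map_sum _ _ _

lemma add_app (A B : Matrix (Fin m) (Fin n) ℝ) (x : Vec n) :
    app (A + B) x = app A x + app B x := by
  simp [app]

lemma sub_app (A B : Matrix (Fin m) (Fin n) ℝ) (x : Vec n) :
    app (A - B) x = app A x - app B x := by
  simp [app]

lemma smul_app (a : ℝ) (A : Matrix (Fin m) (Fin n) ℝ) (x : Vec n) :
    app (a • A) x = a • app A x := by
  simp [app]

lemma zero_app (x : Vec n) : app (0 : Matrix (Fin m) (Fin n) ℝ) x = 0 := by
  simp [app]

lemma one_app (x : Vec n) : app (1 : Matrix (Fin n) (Fin n) ℝ) x = x := by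
  simp [app]

lemma ite_app (p : Prop) [Decidable p] (A B : Matrix (Fin m) (Fin n) ℝ) (x : Vec n) :
    app (if p then A else B) x = if p then app A x else app B x := by
  split_ifs <;> rfl

lemma mul_app (A : Matrix (Fin l) (Fin m) ℝ) (B : Matrix (Fin m) (Fin n) ℝ) (x : Vec n) :
    app (A * B) x = app A (app B x) := by
  ext i
  simp [app_ofLp, Matrix.mulVec_mulVec]

lemma sum_app {ι : Type*} (s : Finset ι) (A : ι → Matrix (Fin m) (Fin n) ℝ) (x : Vec n) :
    app (∑ i ∈ s, A i) x = ∑ i ∈ s, app (A i) x := by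
  simp [app]

lemma norm_app_le (A : Matrix (Fin m) (Fin n) ℝ) (x : Vec n) : ‖app A x‖ ≤ ‖A‖ * ‖x‖ :=
  Matrix.l2_opNorm_mulVec A x

lemma norm_app_le_of_le {A : Matrix (Fin m) (Fin n) ℝ} {x : Vec n} {a b : ℝ} (hA : ‖A‖ ≤ a)
    (hx : ‖x‖ ≤ b) : ‖app A x‖ ≤ a * b :=
  (norm_app_le A x).trans (mul_le_mul hA hx (norm_nonneg _) ((norm_nonneg _).trans hA))

lemma continuous_app {X : Type*} [TopologicalSpace X] {A : X → Matrix (Fin m) (Fin n) ℝ}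
    {x : X → Vec n} (hA : Continuous A) (hx : Continuous x) :
    Continuous fun y => app (A y) (x y) :=
  (PiLp.continuous_toLp 2 _).comp (hA.matrix_mulVec ((PiLp.continuous_ofLp 2 _).comp hx))

lemma norm_le_norm_map_ofReal (A : Matrix (Fin m) (Fin n) ℝ) :
    ‖A‖ ≤ ‖A.map Complex.ofReal‖ := by
  let toComplex {k : ℕ} (y : Vec k) : EuclideanSpace ℂ (Fin k) := WithLp.toLp 2 fun i => (y i : ℂ)
  have norm_toComplex {k : ℕ} (y : Vec k) : ‖toComplex y‖ = ‖y‖ := by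
    simp [toComplex, EuclideanSpace.norm_eq]
  rw [Matrix.l2_opNorm_def A]
  refine ContinuousLinearMap.opNorm_le_bound _ (norm_nonneg _) fun x => ?_
  calc ‖app A x‖ = ‖WithLp.toLp 2 (A.map Complex.ofReal *ᵥ (toComplex x).ofLp)‖ := by
        rw [← norm_toComplex]
        congr 1
        ext i
        simp [toComplex, app_ofLp, Matrix.mulVec, dotProduct]
    _ ≤ ‖A.map Complex.ofReal‖ * ‖toComplex x‖ := Matrix.l2_opNorm_mulVec _ _
    _ = ‖A.map Complex.ofReal‖ * ‖x‖ := by rw [norm_toComplex]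

end Application

section StrongStability

variable {dx du : ℕ} {A : Matrix (Fin dx) (Fin dx) ℝ} {B : Matrix (Fin dx) (Fin du) ℝ}
  {K : Matrix (Fin du) (Fin dx) ℝ} {κ γ : ℝ}

lemma DiagStronglyStable.norm_le (h : DiagStronglyStable A B κ γ K) : ‖K‖ ≤ κ :=
  have ⟨_, _, _, _, _, hK, _⟩ := h
  hK

lemma DiagStronglyStable.norm_pow_le (h : DiagStronglyStable A B κ γ K) (j : ℕ) :
    ‖(A - B * K) ^ j‖ ≤ κ ^ 2 * (1 - γ) ^ j := by
  obtain ⟨l, Q, hQ, hA, hl, -, hQn, hQi⟩ := h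
  have h0 : 0 ≤ 1 - γ := (norm_nonneg _).trans hl
  have hpow : ((A - B * K) ^ j).map Complex.ofReal = Q * Matrix.diagonal l ^ j * Q⁻¹ := by
    obtain ⟨U, rfl⟩ := (Matrix.isUnit_iff_isUnit_det Q).2 hQ
    rw [← Matrix.coe_units_inv] at hA ⊢
    rw [← Units.conj_pow, ← hA]
    exact map_pow Complex.ofRealHom.mapMatrix _ j
  have : ‖Matrix.diagonal l ^ j‖ ≤ (1 - γ) ^ j := by
    rw [Matrix.l2_opNorm_diagonal] at hl
    rw [Matrix.diagonal_pow, Matrix.l2_opNorm_diagonal, pi_norm_le_iff_of_nonneg (pow_nonneg h0 j)]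
    intro i
    rw [Pi.pow_apply, norm_pow]
    exact pow_le_pow_left₀ (norm_nonneg _) ((norm_le_pi_norm l i).trans hl) j
  calc ‖(A - B * K) ^ j‖ ≤ ‖((A - B * K) ^ j).map Complex.ofReal‖ := norm_le_norm_map_ofReal _
    _ = ‖Q * Matrix.diagonal l ^ j * Q⁻¹‖ := by rw [hpow]
    _ ≤ ‖Q‖ * ‖Matrix.diagonal l ^ j‖ * ‖Q⁻¹‖ :=
      (norm_mul_le _ _).trans (mul_le_mul_of_nonneg_right (norm_mul_le _ _) (norm_nonneg _))
    _ ≤ κ * (1 - γ) ^ j * κ := by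
      have hκ : 0 ≤ κ := (norm_nonneg _).trans hQn
      gcongr
    _ = κ ^ 2 * (1 - γ) ^ j := by ring

/-- The quadruples `(K, L, Q, R)` with `QR = 1` that witness the strong stability of `K` through
`A - BK = Q L R`. Carrying the inverse `R` along makes this a closed condition. -/
def stableFactorizations (A : Matrix (Fin dx) (Fin dx) ℝ) (B : Matrix (Fin dx) (Fin du) ℝ)
    (κ γ : ℝ) : Set (Matrix (Fin du) (Fin dx) ℝ × (Fin dx → ℂ) × Matrix (Fin dx) (Fin dx) ℂ ×
      Matrix (Fin dx) (Fin dx) ℂ) :=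
  {(K, l, Q, R) | Q * R = 1 ∧ (A - B * K).map Complex.ofReal = Q * Matrix.diagonal l * R ∧
    ‖l‖ ≤ 1 - γ ∧ ‖K‖ ≤ κ ∧ ‖Q‖ ≤ κ ∧ ‖R‖ ≤ κ}

lemma fst_image_stableFactorizations :
    Prod.fst '' stableFactorizations A B κ γ = {K | DiagStronglyStable A B κ γ K} := by
  ext K
  constructor
  · rintro ⟨⟨K, l, Q, R⟩, ⟨hQR, hA, hl, hK, hQn, hRn⟩, rfl⟩
    have hR : Q⁻¹ = R := Matrix.inv_eq_right_inv hQR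
    refine ⟨l, Q, (Matrix.isUnit_iff_isUnit_det Q).1 (.of_mul_eq_one R hQR), ?_, ?_, hK, hQn, ?_⟩
    · rwa [hR]
    · rwa [Matrix.l2_opNorm_diagonal]
    · rwa [hR]
  · rintro ⟨l, Q, hQ, hA, hl, hK, hQn, hQi⟩
    rw [Matrix.l2_opNorm_diagonal] at hl
    exact ⟨(K, l, Q, Q⁻¹), ⟨Matrix.mul_nonsing_inv _ hQ, hA, hl, hK, hQn, hQi⟩, rfl⟩

lemma isClosed_stableFactorizations : IsClosed (stableFactorizations A B κ γ) := by
  change IsClosed {p : Matrix (Fin du) (Fin dx) ℝ × (Fin dx → ℂ) × Matrix (Fin dx) (Fin dx) ℂ ×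
    Matrix (Fin dx) (Fin dx) ℂ | p.2.2.1 * p.2.2.2 = 1 ∧
      (A - B * p.1).map Complex.ofReal = p.2.2.1 * Matrix.diagonal p.2.1 * p.2.2.2 ∧
      ‖p.2.1‖ ≤ 1 - γ ∧ ‖p.1‖ ≤ κ ∧ ‖p.2.2.1‖ ≤ κ ∧ ‖p.2.2.2‖ ≤ κ}
  have : Continuous fun K : Matrix (Fin du) (Fin dx) ℝ => (A - B * K).map Complex.ofReal :=
    (continuous_const.sub (continuous_const.matrix_mul continuous_id)).matrix_map
      Complex.continuous_ofReal
  have : Continuous fun l : Fin dx → ℂ => Matrix.diagonal l := continuous_id.matrix_diagonal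
  simp only [Set.ofPred_and]
  refine (isClosed_eq ?_ ?_).inter <| (isClosed_eq ?_ ?_).inter <| (isClosed_le ?_ ?_).inter <|
    (isClosed_le ?_ ?_).inter <| (isClosed_le ?_ ?_).inter (isClosed_le ?_ ?_)
  all_goals fun_prop

lemma isCompact_diagStronglyStable (A : Matrix (Fin dx) (Fin dx) ℝ)
    (B : Matrix (Fin dx) (Fin du) ℝ) (κ γ : ℝ) :
    IsCompact {K | DiagStronglyStable A B κ γ K} := by
  have : ProperSpace (Matrix (Fin du) (Fin dx) ℝ) := FiniteDimensional.proper ℝ _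
  have : ProperSpace (Matrix (Fin dx) (Fin dx) ℂ) := FiniteDimensional.proper ℂ _
  rw [← fst_image_stableFactorizations]
  refine IsCompact.image (IsCompact.of_isClosed_subset
    ((isCompact_closedBall 0 κ).prod <| (isCompact_closedBall 0 (1 - γ)).prod <|
      (isCompact_closedBall 0 κ).prod (isCompact_closedBall 0 κ))
    isClosed_stableFactorizations ?_) continuous_fst
  rintro ⟨K, l, Q, R⟩ ⟨-, -, hl, hK, hQ, hR⟩
  simp only [Set.mem_prod, mem_closedBall_zero_iff]
  exact ⟨hK, hl, hQ, hR⟩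

end StrongStability

section GeometricSums

variable {γ : ℝ}

lemma sum_range_one_sub_pow_le (hγ : 0 < γ) (hγ1 : γ < 1) (n : ℕ) :
    ∑ j ∈ Finset.range n, (1 - γ) ^ j ≤ γ⁻¹ := by
  have hgeom := geom_sum_mul_neg (1 - γ) n
  rw [sub_sub_cancel] at hgeom
  rw [← one_div, le_div_iff₀ hγ, hgeom]
  exact sub_le_self _ (pow_nonneg (sub_nonneg.2 hγ1.le) n)

lemma norm_sum_range_le_geometric {E : Type*} [SeminormedAddCommGroup E] (hγ : 0 < γ) (hγ1 : γ < 1)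
    {f : ℕ → E} {c : ℝ} (hc : 0 ≤ c) {n : ℕ} (hf : ∀ j < n, ‖f j‖ ≤ c * (1 - γ) ^ j) :
    ‖∑ j ∈ Finset.range n, f j‖ ≤ c * γ⁻¹ := by
  refine (norm_sum_le_of_le _ fun j hj => hf j (Finset.mem_range.1 hj)).trans ?_
  rw [← Finset.mul_sum]
  exact mul_le_mul_of_nonneg_left (sum_range_one_sub_pow_le hγ hγ1 n) hc

lemma norm_sum_range_sub_sum_range_le {E : Type*} [SeminormedAddCommGroup E] (hγ : 0 < γ)
    (hγ1 : γ < 1) {f : ℕ → E} {c : ℝ} (hc : 0 ≤ c) (hf : ∀ j, ‖f j‖ ≤ c * (1 - γ) ^ j) {m : ℕ}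
    (hm : ∀ j, m ≤ j → f j = 0) (n : ℕ) :
    ‖∑ j ∈ Finset.range m, f j - ∑ j ∈ Finset.range n, f j‖ ≤ c * (1 - γ) ^ n * γ⁻¹ := by
  have hn : 0 ≤ c * (1 - γ) ^ n := mul_nonneg hc (pow_nonneg (sub_nonneg.2 hγ1.le) n)
  rcases le_total m n with h | h
  · rw [← Finset.sum_range_add_sum_Ico f h,
      Finset.sum_eq_zero fun j hj => hm j (Finset.mem_Ico.1 hj).1, add_zero, sub_self, norm_zero]
    exact mul_nonneg hn (inv_nonneg.2 hγ.le)
  · rw [← Finset.sum_range_add_sum_Ico f h, add_sub_cancel_left, Finset.sum_Ico_eq_sum_range]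
    refine norm_sum_range_le_geometric hγ hγ1 hn fun j _ => (hf _).trans_eq ?_
    rw [pow_add, mul_assoc]

end GeometricSums

section Sums

variable {E : Type*} [AddCommMonoid E]

lemma sum_Icc_one_eq_sum_range (f : ℕ → E) (n : ℕ) :
    ∑ t ∈ Finset.Icc 1 n, f t = ∑ t ∈ Finset.range n, f (t + 1) := by
  rw [← Finset.Ico_add_one_right_eq_Icc, Finset.sum_Ico_eq_sum_range, Nat.add_sub_cancel]
  simp only [add_comm]

lemma sum_range_ite_window (f : ℕ → E) {a m n : ℕ} (h : a + m ≤ n) :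
    ∑ i ∈ Finset.range n, (if a ≤ i ∧ i < a + m then f i else 0)
      = ∑ i ∈ Finset.range m, f (a + i) := by
  have hfilter : {i ∈ Finset.range n | a ≤ i ∧ i < a + m} = Finset.Ico a (a + m) := by
    ext i
    simp only [Finset.mem_filter, Finset.mem_range, Finset.mem_Ico]
    lia
  rw [← Finset.sum_filter, hfilter, Finset.sum_Ico_eq_sum_range, Nat.add_sub_cancel_left]

end Sums

section Policies

variable {H dx du : ℕ} {κ κB γ : ℝ}

lemma block_add (M N : Policy H dx du) (i : ℕ) : block (M + N) i = block M i + block N i := by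
  unfold block
  split_ifs
  · rfl
  · rw [add_zero]

lemma block_smul (a : ℝ) (M : Policy H dx du) (i : ℕ) : block (a • M) i = a • block M i := by
  unfold block
  split_ifs
  · rfl
  · rw [smul_zero]

lemma block_of_le {M : Policy H dx du} {i : ℕ} (h : H ≤ i) : block M i = 0 := dif_neg h.not_gt

lemma block_apply (M : Policy H dx du) (p : Fin H × Fin du × Fin dx) :
    block M p.1 p.2.1 p.2.2 = M p := by
  simp [block]

lemma continuous_block (i : ℕ) : Continuous fun M : Policy H dx du => block M i :=
  LinearMap.continuous_of_finiteDimensional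
    { toFun := fun M : Policy H dx du => block M i
      map_add' := fun M N => block_add M N i
      map_smul' := fun a M => block_smul a M i }

/-- The policy with prescribed blocks. -/
def ofBlocks (H : ℕ) (G : ℕ → Matrix (Fin du) (Fin dx) ℝ) : Policy H dx du :=
  WithLp.toLp 2 fun p => G p.1 p.2.1 p.2.2

lemma block_ofBlocks (G : ℕ → Matrix (Fin du) (Fin dx) ℝ) {i : ℕ} (h : i < H) :
    block (ofBlocks H G) i = G i := by
  ext a b
  simp [block, ofBlocks, h]

lemma convex_policySet : Convex ℝ (policySet H dx du κ κB γ) := by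
  intro M hM N hN a b ha hb hab i hi
  rw [block_add, block_smul, block_smul, ← mem_closedBall_zero_iff]
  exact convex_closedBall 0 _ (mem_closedBall_zero_iff.2 (hM i hi))
    (mem_closedBall_zero_iff.2 (hN i hi)) ha hb hab

lemma isClosed_policySet : IsClosed (policySet H dx du κ κB γ) := by
  simp only [policySet, Set.ofPred_forall]
  exact isClosed_iInter fun i => isClosed_iInter fun _ =>
    isClosed_le (continuous_block _).norm continuous_const

lemma abs_entry_le_norm {m n : ℕ} (A : Matrix (Fin m) (Fin n) ℝ) (a : Fin m) (b : Fin n) :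
    |A a b| ≤ ‖A‖ :=
  calc |A a b| = ‖app A (EuclideanSpace.single b 1) a‖ := by simp [app_ofLp, Real.norm_eq_abs]
    _ ≤ ‖app A (EuclideanSpace.single b 1)‖ := PiLp.norm_apply_le _ a
    _ ≤ ‖A‖ := by simpa using norm_app_le A (EuclideanSpace.single b 1)

lemma isCompact_policySet : IsCompact (policySet H dx du κ κB γ) := by
  have hbox : IsCompact ((EuclideanSpace.equiv (Fin H × Fin du × Fin dx) ℝ) ⁻¹'
      Set.univ.pi fun p => Metric.closedBall 0 (κ ^ 3 * κB * (1 - γ) ^ (p.1.1 + 1))) :=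
    (EuclideanSpace.equiv _ ℝ).toHomeomorph.isCompact_preimage.2
      (isCompact_univ_pi fun _ => isCompact_closedBall _ _)
  refine hbox.of_isClosed_subset isClosed_policySet fun M hM p _ => mem_closedBall_zero_iff.2 ?_
  calc |M p| = |block M p.1 p.2.1 p.2.2| := by rw [block_apply]
    _ ≤ ‖block M p.1‖ := abs_entry_le_norm _ _ _
    _ ≤ κ ^ 3 * κB * (1 - γ) ^ (p.1.1 + 1) := hM (p.1 + 1) (Finset.mem_Icc.2 ⟨by lia, p.1.2⟩)

/-- The disturbance action `∑ M^{[i]} h_i` for the noise history `h`, where `h i` is the noise of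
age `i`, as a linear map of the policy. -/
def input (h : ℕ → Vec dx) : Policy H dx du →ₗ[ℝ] Vec du where
  toFun M := ∑ i ∈ Finset.range H, app (block M i) (h i)
  map_add' M N := by simp only [block_add, add_app, Finset.sum_add_distrib]
  map_smul' a M := by simp only [block_smul, smul_app, Finset.smul_sum, RingHom.id_apply]

lemma input_apply (h : ℕ → Vec dx) (M : Policy H dx du) :
    input h M = ∑ i ∈ Finset.range H, app (block M i) (h i) := rfl

lemma input_congr {h h' : ℕ → Vec dx} (hh : ∀ i < H, h i = h' i) (M : Policy H dx du) :
    input h M = input h' M := by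
  rw [input_apply, input_apply]
  exact Finset.sum_congr rfl fun i hi => by rw [hh i (Finset.mem_range.1 hi)]

lemma input_eq_zero {h : ℕ → Vec dx} (hh : ∀ i, h i = 0) (M : Policy H dx du) :
    input h M = 0 := by
  simp only [input_apply, hh, app_zero, Finset.sum_const_zero]

lemma continuous_input (M : Policy H dx du) : Continuous fun h : ℕ → Vec dx => input h M := by
  simp only [input_apply]
  exact continuous_finsetSum _ fun i _ => continuous_app continuous_const (continuous_apply i)

lemma norm_input_le (hγ : 0 < γ) (hγ1 : γ < 1) (hκ : 0 ≤ κ ^ 3 * κB) {M : Policy H dx du}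
    (hM : M ∈ policySet H dx du κ κB γ) {W : ℝ} {h : ℕ → Vec dx} (hh : ∀ i, ‖h i‖ ≤ W) :
    ‖input h M‖ ≤ κ ^ 3 * κB * γ⁻¹ * W := by
  have hW : 0 ≤ W := (norm_nonneg _).trans (hh 0)
  have hblock : ∀ i < H, ‖block M i‖ ≤ κ ^ 3 * κB * (1 - γ) ^ i := fun i hi =>
    (hM (i + 1) (Finset.mem_Icc.2 ⟨by lia, hi⟩)).trans <| mul_le_mul_of_nonneg_left
      (pow_le_pow_of_le_one (sub_nonneg.2 hγ1.le) (by linarith) i.le_succ) hκ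
  calc ‖input h M‖ ≤ κ ^ 3 * κB * W * γ⁻¹ :=
        norm_sum_range_le_geometric hγ hγ1 (mul_nonneg hκ hW) fun i hi =>
          (norm_app_le_of_le (hblock i hi) (hh i)).trans_eq (by ring)
    _ = κ ^ 3 * κB * γ⁻¹ * W := by ring

end Policies

section Responses

variable {H dx du : ℕ} (F : Matrix (Fin dx) (Fin dx) ℝ) (B : Matrix (Fin dx) (Fin du) ℝ)

/-- What the action and the noise of age `j` contribute to the present state of the system
`x ↦ F x + B u + w` in which the action `u` is the disturbance action of the policy `M`. -/
def contribution (h : ℕ → Vec dx) (M : Policy H dx du) (j : ℕ) : Vec dx :=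
  app (F ^ j) (app B (input (fun i => h (j + 1 + i)) M) + h j)

/-- The state reached from `0` after `H + 1` steps of the system `x ↦ F x + B u + w` under the
policy `M`. -/
def response (h : ℕ → Vec dx) (M : Policy H dx du) : Vec dx :=
  ∑ j ∈ Finset.range (H + 1), contribution F B h M j

/-- The linear part of the affine map `M ↦ response F B h M`. -/
def steer (h : ℕ → Vec dx) : Policy H dx du →ₗ[ℝ] Vec dx where
  toFun M := ∑ j ∈ Finset.range (H + 1), app (F ^ j) (app B (input (fun i => h (j + 1 + i)) M))
  map_add' M N := by simp only [map_add, app_add, Finset.sum_add_distrib]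
  map_smul' a M := by simp only [map_smul, app_smul, Finset.smul_sum, RingHom.id_apply]

lemma response_sub_response (h : ℕ → Vec dx) (M N : Policy H dx du) :
    response F B h M - response F B h N = steer F B h (M - N) := by
  simp only [response, contribution, app_add, Finset.sum_add_distrib, add_sub_add_right_eq_sub,
    map_sub]
  rfl

lemma response_congr {h h' : ℕ → Vec dx} (hh : ∀ i < 2 * H + 1, h i = h' i)
    (M : Policy H dx du) : response F B h M = response F B h' M := by
  refine Finset.sum_congr rfl fun j hj => ?_
  rw [Finset.mem_range] at hj
  rw [contribution, contribution, hh j (by lia), input_congr fun i hi => hh (j + 1 + i) (by lia)]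

lemma continuous_response (M : Policy H dx du) :
    Continuous fun h : ℕ → Vec dx => response F B h M := by
  refine continuous_finsetSum _ fun j _ => continuous_app continuous_const
    ((continuous_app continuous_const ?_).add (continuous_apply j))
  exact (continuous_input M).comp (continuous_pi fun i => continuous_apply (j + 1 + i))

variable {F B}

lemma norm_contribution_le {M : Policy H dx du} {h : ℕ → Vec dx} {k κB γ a W : ℝ}
    (hF : ∀ j, ‖F ^ j‖ ≤ k * (1 - γ) ^ j) (hB : ‖B‖ ≤ κB) (hh : ∀ i, ‖h i‖ ≤ W)
    (ha : ∀ j, ‖input (fun i => h (j + i)) M‖ ≤ a) (j : ℕ) :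
    ‖contribution F B h M j‖ ≤ k * (κB * a + W) * (1 - γ) ^ j :=
  (norm_app_le_of_le (hF j) ((norm_add_le _ _).trans
    (add_le_add (norm_app_le_of_le hB (ha (j + 1))) (hh j)))).trans_eq (by ring)

end Responses

section Histories

variable {H dx du N : ℕ}

/-- A finite noise history, extended by `0`. -/
def extend (n : Fin N → Vec dx) (i : ℕ) : Vec dx :=
  if h : i < N then n ⟨i, h⟩ else 0

/-- The noise of age `i` at time `t`, which is `0` before time `1`. -/
def history (w : ℕ → Vec dx) (t i : ℕ) : Vec dx :=
  if i + 1 < t then w (t - 1 - i) else 0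

lemma extend_val (n : Fin N → Vec dx) (i : Fin N) : extend n i = n i := dif_pos i.2

lemma sum_fin_eq_sum_extend {E : Type*} [AddCommMonoid E] (f : ℕ → Vec dx → E)
    (n : Fin N → Vec dx) :
    ∑ i : Fin N, f i (n i) = ∑ i ∈ Finset.range N, f i (extend n i) := by
  simp only [Finset.sum_range, extend_val]

lemma continuous_extend : Continuous (extend : (Fin N → Vec dx) → ℕ → Vec dx) := by
  refine continuous_pi fun i => ?_
  unfold extend
  split_ifs
  · exact continuous_apply _
  · exact continuous_const

lemma continuous_history (t : ℕ) :
    Continuous fun w : ℕ → Vec dx => history w t := by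
  refine continuous_pi fun i => ?_
  unfold history
  split_ifs
  · exact continuous_apply _
  · exact continuous_const

lemma norm_extend_le {n : Fin N → Vec dx} {W : ℝ} (hW : 0 ≤ W) (hn : ∀ i, ‖n i‖ ≤ W) (i : ℕ) :
    ‖extend n i‖ ≤ W := by
  unfold extend
  split_ifs
  · exact hn _
  · rwa [norm_zero]

lemma norm_history_le {w : ℕ → Vec dx} {W : ℝ} (hw : ∀ s, ‖w s‖ ≤ W) (t i : ℕ) :
    ‖history w t i‖ ≤ W := by
  unfold history
  split_ifs
  · exact hw _
  · rw [norm_zero]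
    exact (norm_nonneg _).trans (hw 0)

lemma history_add_one_of_lt (w : ℕ → Vec dx) {t i : ℕ} (h : i < t) :
    history w (t + 1) i = w (t - i) :=
  if_pos (Nat.succ_lt_succ h)

lemma history_add_one_of_le (w : ℕ → Vec dx) {t i : ℕ} (h : t ≤ i) :
    history w (t + 1) i = 0 :=
  if_neg (by lia)

lemma history_sub (w : ℕ → Vec dx) {s j : ℕ} (t : ℕ) (h : j + s = t) (i : ℕ) :
    history w s i = history w t (j + i) := by
  subst h
  unfold history
  split_ifs
  · congr 1
    lia
  · lia
  · lia
  · rfl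

variable (A : Matrix (Fin dx) (Fin dx) ℝ) (B : Matrix (Fin dx) (Fin du) ℝ)
  (K₀ : Matrix (Fin du) (Fin dx) ℝ)

lemma surrogateState_eq (M : Policy H dx du) (n : Fin (2 * H + 1) → Vec dx) :
    surrogateState A B K₀ M n = response (A - B * K₀) B (extend n) M := by
  set F := A - B * K₀ with hF
  have hwindow : ∀ j ∈ Finset.range (H + 1), ∑ i ∈ Finset.range (2 * H + 1),
      app (if j + 1 ≤ i ∧ i ≤ j + H then F ^ j * B * block M (i - j - 1) else 0) (extend n i)
      = app (F ^ j) (app B (input (fun i => extend n (j + 1 + i)) M)) := by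
    intro j hj
    have h := sum_range_ite_window (fun i => app (F ^ j * B * block M (i - j - 1)) (extend n i))
      (show j + 1 + H ≤ 2 * H + 1 by have := Finset.mem_range.1 hj; lia)
    simp only [Nat.sub_sub, Nat.add_sub_cancel_left, mul_app] at h
    simp only [ite_app, zero_app, mul_app, input_apply, app_sum, ← h, Nat.sub_sub,
      Nat.lt_iff_add_one_le, Nat.add_right_comm j 1 H, Nat.add_le_add_iff_right]
  have hnoise : ∑ i ∈ Finset.range (2 * H + 1), app (if i ≤ H then F ^ i else 0) (extend n i)
      = ∑ i ∈ Finset.range (H + 1), app (F ^ i) (extend n i) := by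
    have h := sum_range_ite_window (fun i => app (F ^ i) (extend n i))
      (show 0 + (H + 1) ≤ 2 * H + 1 by lia)
    simp only [zero_le, true_and, zero_add, Nat.lt_add_one_iff] at h
    simp only [ite_app, zero_app, h]
  rw [surrogateState, sum_fin_eq_sum_extend fun i => app (transfer A B K₀ M i)]
  simp only [transfer, add_app, sum_app, Finset.sum_add_distrib, ← hF]
  rw [hnoise, Finset.sum_comm, Finset.sum_congr rfl hwindow, ← Finset.sum_add_distrib]
  simp only [response, contribution, app_add, add_comm]

lemma surrogateAction_eq (M : Policy H dx du) (n : Fin (2 * H + 1) → Vec dx) :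
    surrogateAction A B K₀ M n
      = -app K₀ (response (A - B * K₀) B (extend n) M) + input (extend n) M := by
  rw [surrogateAction, surrogateState_eq, input_apply, Finset.sum_range]
  simp only [extend, show ∀ i : Fin H, i.1 < 2 * H + 1 from fun i => by lia, dite_true]

lemma policyCtrl_eq (M : ℕ → Policy H dx du) (w : ℕ → Vec dx) (t : ℕ) (x : Vec dx) :
    policyCtrl K₀ M w t x = -app K₀ x + input (history w t) (M t) := by
  rw [policyCtrl, input_apply, sum_Icc_one_eq_sum_range]
  simp only [history, Nat.add_sub_cancel, apply_ite (app _), app_zero, Nat.sub_sub, add_comm]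

end Histories

section Dynamics

variable {dx : ℕ} {F : Matrix (Fin dx) (Fin dx) ℝ} {z e : ℕ → Vec dx}

lemma eq_sum_of_recursion (h0 : z 0 = 0) (hz : ∀ t, z (t + 1) = app F (z t) + e (t + 1)) (t : ℕ) :
    z t = ∑ j ∈ Finset.range t, app (F ^ j) (e (t - j)) := by
  induction t with
  | zero => exact h0
  | succ t ih =>
    rw [hz, ih, Finset.sum_range_succ', app_sum]
    simp only [pow_succ', mul_app, Nat.add_sub_add_right, pow_zero, one_app, Nat.sub_zero]

variable {k γ : ℝ}

lemma norm_le_of_recursion (hγ : 0 < γ) (hγ1 : γ < 1) (hk : 0 ≤ k)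
    (hF : ∀ j, ‖F ^ j‖ ≤ k * (1 - γ) ^ j) (h0 : z 0 = 0)
    (hz : ∀ t, z (t + 1) = app F (z t) + e (t + 1)) {b : ℝ} (hb : 0 ≤ b) {t : ℕ}
    (he : ∀ s < t, ‖e (s + 1)‖ ≤ b) : ‖z t‖ ≤ k * b * γ⁻¹ := by
  rw [eq_sum_of_recursion h0 hz]
  refine norm_sum_range_le_geometric hγ hγ1 (mul_nonneg hk hb) fun j hj => ?_
  obtain ⟨s, hs, hst⟩ : ∃ s < t, t - j = s + 1 := ⟨t - j - 1, by lia, by lia⟩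
  rw [hst]
  exact (norm_app_le_of_le (hF j) (he s hs)).trans_eq (by ring)

-- Young's inequality for the convolution of `k (1 - γ) ^ j` with `‖e‖`.
lemma sum_norm_le_of_recursion (hγ : 0 < γ) (hγ1 : γ < 1) (hk : 0 ≤ k)
    (hF : ∀ j, ‖F ^ j‖ ≤ k * (1 - γ) ^ j) (h0 : z 0 = 0)
    (hz : ∀ t, z (t + 1) = app F (z t) + e (t + 1)) (T : ℕ) :
    ∑ t ∈ Finset.range T, ‖z t‖ ≤ k * γ⁻¹ * ∑ t ∈ Finset.range T, ‖e (t + 1)‖ := by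
  have hpow (j : ℕ) : 0 ≤ k * (1 - γ) ^ j := mul_nonneg hk (pow_nonneg (sub_nonneg.2 hγ1.le) j)
  have hS : 0 ≤ ∑ t ∈ Finset.range T, ‖e (t + 1)‖ := Finset.sum_nonneg fun _ _ => norm_nonneg _
  have hterm (t : ℕ) :
      ‖z (t + 1)‖ ≤ ∑ j ∈ Finset.range (t + 1), k * (1 - γ) ^ j * ‖e (t - j + 1)‖ := by
    rw [eq_sum_of_recursion h0 hz]
    refine norm_sum_le_of_le _ fun j hj => ?_
    rw [Nat.sub_add_comm (Finset.mem_range_succ_iff.1 hj)]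
    exact norm_app_le_of_le (hF j) le_rfl
  calc ∑ t ∈ Finset.range T, ‖z t‖ ≤ ∑ t ∈ Finset.range (T + 1), ‖z t‖ :=
        Finset.sum_le_sum_of_subset_of_nonneg (Finset.range_mono T.le_succ)
          fun _ _ _ => norm_nonneg _
    _ = ∑ t ∈ Finset.range T, ‖z (t + 1)‖ := by
        rw [Finset.sum_range_succ', h0, norm_zero, add_zero]
    _ ≤ ∑ t ∈ Finset.range T, ∑ j ∈ Finset.range (t + 1), k * (1 - γ) ^ j * ‖e (t - j + 1)‖ :=
        Finset.sum_le_sum fun t _ => hterm t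
    _ = ∑ j ∈ Finset.range T, k * (1 - γ) ^ j * ∑ s ∈ Finset.range (T - j), ‖e (s + 1)‖ := by
        simp only [Finset.mul_sum]
        exact Finset.sum_range_diag_flip T fun j s => k * (1 - γ) ^ j * ‖e (s + 1)‖
    _ ≤ ∑ j ∈ Finset.range T, k * (1 - γ) ^ j * ∑ s ∈ Finset.range T, ‖e (s + 1)‖ :=
        Finset.sum_le_sum fun j _ => mul_le_mul_of_nonneg_left
          (Finset.sum_le_sum_of_subset_of_nonneg (Finset.range_mono (T.sub_le j))
            fun _ _ _ => norm_nonneg _) (hpow j)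
    _ = k * (∑ j ∈ Finset.range T, (1 - γ) ^ j) * ∑ s ∈ Finset.range T, ‖e (s + 1)‖ := by
        rw [← Finset.sum_mul, ← Finset.mul_sum]
    _ ≤ k * γ⁻¹ * ∑ t ∈ Finset.range T, ‖e (t + 1)‖ :=
        mul_le_mul_of_nonneg_right
          (mul_le_mul_of_nonneg_left (sum_range_one_sub_pow_le hγ hγ1 T) hk) hS

end Dynamics

section Trajectories

variable {H dx du : ℕ} (A : Matrix (Fin dx) (Fin dx) ℝ) (B : Matrix (Fin dx) (Fin du) ℝ)
  (K K₀ : Matrix (Fin du) (Fin dx) ℝ) (w : ℕ → Vec dx)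

lemma state_one (ctrl : ℕ → Vec dx → Vec du) : state A B ctrl w 1 = 0 := rfl

lemma state_add_two (ctrl : ℕ → Vec dx → Vec du) (t : ℕ) :
    state A B ctrl w (t + 2) = app (A - B * K₀) (state A B ctrl w (t + 1))
      + (app B (ctrl (t + 1) (state A B ctrl w (t + 1)) + app K₀ (state A B ctrl w (t + 1)))
        + w (t + 1)) := by
  rw [state, sub_app, mul_app, app_add]
  abel

lemma state_linearCtrl_add_two (t : ℕ) :
    state A B (linearCtrl K w) w (t + 2)
      = app (A - B * K) (state A B (linearCtrl K w) w (t + 1)) + w (t + 1) := by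
  rw [state_add_two A B K, linearCtrl, neg_add_cancel, app_zero, zero_add]

lemma state_policyCtrl_add_two (M : ℕ → Policy H dx du) (t : ℕ) :
    state A B (policyCtrl K₀ M w) w (t + 2)
      = app (A - B * K₀) (state A B (policyCtrl K₀ M w) w (t + 1))
        + (app B (input (history w (t + 1)) (M (t + 1))) + w (t + 1)) := by
  rw [state_add_two A B K₀, policyCtrl_eq, neg_add_cancel_comm]

lemma state_linearCtrl_eq_sum (t : ℕ) :
    state A B (linearCtrl K w) w (t + 1)
      = ∑ j ∈ Finset.range t, app ((A - B * K) ^ j) (w (t - j)) :=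
  eq_sum_of_recursion (z := fun t => state A B (linearCtrl K w) w (t + 1)) (state_one A B w _)
    (state_linearCtrl_add_two A B K w) t

lemma state_policyCtrl_eq_sum (M : Policy H dx du) (t : ℕ) :
    state A B (policyCtrl K₀ (fun _ => M) w) w (t + 1)
      = ∑ j ∈ Finset.range t, contribution (A - B * K₀) B (history w (t + 1)) M j := by
  rw [eq_sum_of_recursion (z := fun t => state A B (policyCtrl K₀ (fun _ => M) w) w (t + 1))
    (e := fun t => app B (input (history w t) M) + w t) (state_one A B w _)
    (state_policyCtrl_add_two A B K₀ w _) t]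
  refine Finset.sum_congr rfl fun j hj => ?_
  rw [Finset.mem_range] at hj
  simp only [contribution, history_add_one_of_lt w hj,
    input_congr (fun i _ => history_sub w (t + 1) (show j + 1 + (t - j) = t + 1 by lia) i) M]

lemma contribution_history_of_le (F : Matrix (Fin dx) (Fin dx) ℝ) (M : Policy H dx du) {t j : ℕ}
    (h : t ≤ j) : contribution F B (history w (t + 1)) M j = 0 := by
  rw [contribution, input_eq_zero fun i => history_add_one_of_le w (by lia),
    history_add_one_of_le w h, app_zero, add_zero, app_zero]

end Trajectories

section Optimization

variable {F : Type*} [NormedAddCommGroup F] [InnerProductSpace ℝ F] {C : Set F}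

lemma inner_sub_le_zero_of_forall_norm_le (hC : Convex ℝ C) {u v : F} (hv : v ∈ C)
    (hmin : ∀ x ∈ C, ‖u - v‖ ≤ ‖u - x‖) {x : F} (hx : x ∈ C) : inner ℝ (u - v) (x - v) ≤ 0 := by
  have : Nonempty C := ⟨⟨v, hv⟩⟩
  have hbdd : BddBelow (Set.range fun y : C => ‖u - y‖) :=
    ⟨0, Set.forall_mem_range.2 fun _ => norm_nonneg _⟩
  exact (norm_eq_iInf_iff_real_inner_le_zero hC hv).1
    (le_antisymm (le_ciInf fun y => hmin y y.2) (ciInf_le hbdd ⟨v, hv⟩)) x hx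

-- Adding the variational inequalities of the two projections `p'` and `q` gives
-- `‖p' - q‖² ≤ (1 - s) ⟪p - q, p' - q⟫`.
lemma norm_sub_le_of_projected_step (hC : Convex ℝ C) {p p' q m : F} {s : ℝ} (hs : 0 ≤ s)
    (hp' : p' ∈ C) (hq : q ∈ C)
    (hmin' : ∀ x ∈ C, ‖p - s • (p - m) - p'‖ ≤ ‖p - s • (p - m) - x‖)
    (hmin : ∀ x ∈ C, ‖m - q‖ ≤ ‖m - x‖) : ‖p' - q‖ ≤ |1 - s| * ‖p - q‖ := by
  have hstep := inner_sub_le_zero_of_forall_norm_le hC hp' hmin' hq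
  have hopt := mul_nonpos_of_nonneg_of_nonpos hs
    (inner_sub_le_zero_of_forall_norm_le hC hq hmin hp')
  have hsplit : p - s • (p - m) - p' = ((1 - s) • (p - q) + s • (m - q)) - (p' - q) := by module
  rw [hsplit, ← neg_sub p' q, inner_neg_right, inner_sub_left, inner_add_left,
    real_inner_smul_left _ _ s, real_inner_self_eq_norm_sq] at hstep
  have hsq : ‖p' - q‖ * ‖p' - q‖ ≤ |1 - s| * ‖p - q‖ * ‖p' - q‖ :=
    calc ‖p' - q‖ * ‖p' - q‖ ≤ inner ℝ ((1 - s) • (p - q)) (p' - q) := by linarith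
      _ ≤ |1 - s| * ‖p - q‖ * ‖p' - q‖ :=
        (real_inner_le_norm _ _).trans_eq (by rw [norm_smul, Real.norm_eq_abs])
  rcases (norm_nonneg (p' - q)).eq_or_lt with h | h
  · rw [← h]
    positivity
  · exact le_of_mul_le_mul_right hsq h

variable {E : ℕ → ℝ} {D : ℝ} {T k : ℕ}

lemma sum_Icc_one_le (hED : ∀ t, 1 ≤ t → t ≤ T → E t ≤ D) {N : ℕ} (hN : N ≤ T) :
    ∑ t ∈ Finset.Icc 1 N, E t ≤ N * D := by
  refine (Finset.sum_le_card_nsmul _ _ D fun t ht => ?_).trans_eq (by simp)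
  rw [Finset.mem_Icc] at ht
  exact hED t ht.1 (ht.2.trans hN)

-- The left side does not increase with `N`.
lemma sum_add_mul_le_of_contraction (hE : ∀ t, 0 ≤ E t) (hED : ∀ t, 1 ≤ t → t ≤ T → E t ≤ D)
    (hk : 2 ≤ k) (hstep : ∀ t, k ≤ t → t < T → t * E (t + 1) ≤ (t - 2) * E t) {N : ℕ}
    (hkN : k ≤ N) (hNT : N ≤ T) : ∑ t ∈ Finset.Icc 1 N, E t + (N - 1) * E N ≤ 2 * k * D := by
  induction N, hkN using Nat.le_induction with
  | base =>
    have hinitial := sum_Icc_one_le hED hNT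
    have hlast : (k - 1) * E k ≤ (k - 1) * D :=
      mul_le_mul_of_nonneg_left (hED k (by lia) hNT)
        (sub_nonneg.2 (by exact_mod_cast one_le_two.trans hk))
    have hD : 0 ≤ D := (hE k).trans (hED k (by lia) hNT)
    linarith
  | succ N hkN ih =>
    have hNE := hstep N hkN hNT
    have hN : (2 : ℝ) ≤ N := by exact_mod_cast hk.trans hkN
    have hdecr : E (N + 1) ≤ E N := by nlinarith [hE N]
    rw [Finset.sum_Icc_succ_top (by lia)]
    push_cast
    linarith [ih (by lia)]

lemma sum_le_of_contraction (hE : ∀ t, 0 ≤ E t) (hD : 0 ≤ D)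
    (hED : ∀ t, 1 ≤ t → t ≤ T → E t ≤ D) (hk : 2 ≤ k)
    (hstep : ∀ t, k ≤ t → t < T → t * E (t + 1) ≤ (t - 2) * E t) :
    ∑ t ∈ Finset.Icc 1 T, E t ≤ 2 * k * D := by
  rcases le_or_gt T k with h | h
  · have hTk : (T : ℝ) * D ≤ k * D := by gcongr
    have hkD : 0 ≤ k * D := by positivity
    linarith [sum_Icc_one_le hED le_rfl]
  · have hlast : 0 ≤ (T - 1) * E T :=
      mul_nonneg (sub_nonneg.2 (by exact_mod_cast show 1 ≤ T by lia)) (hE T)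
    linarith [sum_add_mul_le_of_contraction hE hED hk hstep h.le le_rfl]

end Optimization

section Quadratic

variable {ι : Type*} [Fintype ι] {U : Matrix ι ι ℝ}

lemma exists_sqNorm_eq_norm_sq (hU : U.PosSemidef) :
    ∃ S : EuclideanSpace ℝ ι →L[ℝ] EuclideanSpace ℝ ι, ∀ V, sqNorm U V = ‖S V‖ ^ 2 := by
  classical
  open scoped MatrixOrder in
  obtain ⟨R, hR⟩ := CStarAlgebra.nonneg_iff_eq_star_mul_self.1 hU.nonneg
  refine ⟨Matrix.toEuclideanCLM (𝕜 := ℝ) R, fun V => ?_⟩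
  rw [← real_inner_self_eq_norm_sq, sqNorm, hR, EuclideanSpace.inner_eq_star_dotProduct,
    ← Matrix.mulVec_mulVec, Matrix.dotProduct_mulVec, Matrix.star_eq_conjTranspose,
    Matrix.conjTranspose_eq_transpose_of_trivial, Matrix.vecMul_transpose]
  simp

lemma sqNorm_eq_inner [DecidableEq ι] (V : EuclideanSpace ℝ ι) :
    sqNorm U V = inner ℝ (Matrix.toEuclideanCLM (𝕜 := ℝ) U V) V := by
  rw [EuclideanSpace.inner_eq_star_dotProduct, star_trivial, Matrix.ofLp_toEuclideanCLM, sqNorm]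

lemma inner_toEuclideanCLM_comm [DecidableEq ι] (hU : U.IsHermitian) (V V' : EuclideanSpace ℝ ι) :
    inner ℝ (Matrix.toEuclideanCLM (𝕜 := ℝ) U V) V'
      = inner ℝ (Matrix.toEuclideanCLM (𝕜 := ℝ) U V') V := by
  rw [real_inner_comm V]
  exact Matrix.isSymmetric_toEuclideanLin_iff.2 hU V V'

lemma sqNorm_sub (hU : U.IsHermitian) (V V' : EuclideanSpace ℝ ι) :
    sqNorm U (V - V') = sqNorm U V - 2 * ((U *ᵥ V'.ofLp) ⬝ᵥ V.ofLp) + sqNorm U V' := by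
  classical
  have hcross : (U *ᵥ V'.ofLp) ⬝ᵥ V.ofLp = inner ℝ (Matrix.toEuclideanCLM (𝕜 := ℝ) U V') V := by
    rw [EuclideanSpace.inner_eq_star_dotProduct, star_trivial, Matrix.ofLp_toEuclideanCLM,
      dotProduct_comm]
  simp only [sqNorm_eq_inner, map_sub, inner_sub_left, inner_sub_right, hcross,
    inner_toEuclideanCLM_comm hU V V']
  ring

lemma exists_eq_add_sqNorm_sub (hU : U.PosDef) (c₀ : ℝ) (b : ι → ℝ) :
    ∃ (m : EuclideanSpace ℝ ι) (c₁ : ℝ),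
      ∀ V : EuclideanSpace ℝ ι, c₀ + 2 * (b ⬝ᵥ V.ofLp) + sqNorm U V = c₁ + sqNorm U (V - m) := by
  classical
  have hdet : IsUnit U.det := (Matrix.isUnit_iff_isUnit_det U).1 hU.isUnit
  set m : EuclideanSpace ℝ ι := WithLp.toLp 2 (-(U⁻¹ *ᵥ b)) with hm
  have hUm : U *ᵥ m.ofLp = -b := by
    rw [hm, Matrix.mulVec_neg, Matrix.mulVec_mulVec, Matrix.mul_nonsing_inv _ hdet,
      Matrix.one_mulVec]
  refine ⟨m, c₀ - sqNorm U m, fun V => ?_⟩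
  rw [sqNorm_sub hU.isHermitian, hUm, neg_dotProduct]
  ring

lemma hasGradientAt_sqNorm_sub [DecidableEq ι] (hU : U.IsHermitian) (m V : EuclideanSpace ℝ ι)
    (c₁ r : ℝ) :
    HasGradientAt (fun V => r * (c₁ + sqNorm U (V - m)))
      ((2 * r) • Matrix.toEuclideanCLM (𝕜 := ℝ) U (V - m)) V := by
  have hsub : HasFDerivAt (fun V => V - m) (ContinuousLinearMap.id ℝ _) V :=
    (hasFDerivAt_id V).sub_const m
  have hinner := ((((Matrix.toEuclideanCLM (𝕜 := ℝ) U).hasFDerivAt.comp V hsub).inner ℝ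
    hsub).const_add c₁).const_mul r
  simp only [sqNorm_eq_inner]
  refine hasGradientAt_iff_hasFDerivAt.2 (hinner.congr_fderiv ?_)
  ext V'
  simp only [smul_apply, ContinuousLinearMap.comp_apply,
    ContinuousLinearMap.prod_apply, ContinuousLinearMap.id_apply, fderivInnerCLM_apply,
    Function.comp_apply, InnerProductSpace.toDual_apply_apply, real_inner_smul_left, smul_eq_mul,
    inner_toEuclideanCLM_comm hU V' (V - m)]
  ring

lemma toEuclideanLin_inv_gradient [DecidableEq ι] (hU : U.PosDef) (m V : EuclideanSpace ℝ ι)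
    (c₁ r : ℝ) :
    Matrix.toEuclideanLin U⁻¹ (∇ (fun V => r * (c₁ + sqNorm U (V - m))) V)
      = (2 * r) • (V - m) := by
  have hdet : IsUnit U.det := (Matrix.isUnit_iff_isUnit_det U).1 hU.isUnit
  rw [(hasGradientAt_sqNorm_sub hU.isHermitian m V c₁ r).gradient, map_smul]
  congr 1
  rw [Matrix.toLpLin_apply, Matrix.ofLp_toEuclideanCLM, Matrix.mulVec_mulVec,
    Matrix.nonsing_inv_mul _ hdet, Matrix.one_mulVec, WithLp.toLp_ofLp]

variable {C : Set (EuclideanSpace ℝ ι)}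

lemma exists_isProjection (hU : U.PosSemidef) (hC : IsCompact C) (hne : C.Nonempty)
    (m : EuclideanSpace ℝ ι) : ∃ N, IsProjection U C m N := by
  obtain ⟨S, hS⟩ := exists_sqNorm_eq_norm_sq hU
  have hcont : ContinuousOn (fun V => ‖S (V - m)‖ ^ 2) C := by fun_prop
  obtain ⟨N, hN, hmin⟩ := hC.exists_isMinOn hne hcont
  exact ⟨N, hN, fun V hV => by rw [hS, hS]; exact hmin hV⟩

lemma sqrt_sqNorm_sub_le_of_isProjection (hU : U.PosSemidef) (hC : Convex ℝ C)
    {V V' N m : EuclideanSpace ℝ ι} {s : ℝ} (hs : 0 ≤ s)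
    (hV' : IsProjection U C (V - s • (V - m)) V') (hN : IsProjection U C m N) :
    √(sqNorm U (V' - N)) ≤ |1 - s| * √(sqNorm U (V - N)) := by
  obtain ⟨S, hS⟩ := exists_sqNorm_eq_norm_sq hU
  have hclosest {u v : EuclideanSpace ℝ ι} (huv : IsProjection U C u v) :
      ∀ x ∈ S '' C, ‖S u - S v‖ ≤ ‖S u - x‖ := by
    rintro _ ⟨x, hx, rfl⟩
    have h := huv.2 x hx
    rw [hS, hS, sq_le_sq₀ (norm_nonneg _) (norm_nonneg _), map_sub, map_sub] at h
    rwa [norm_sub_rev, norm_sub_rev _ (S x)]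
  have hstep := hclosest hV'
  simp only [map_sub, map_smul] at hstep
  simp only [hS, Real.sqrt_sq (norm_nonneg _), map_sub]
  exact norm_sub_le_of_projected_step (hC.linear_image S.toLinearMap) hs
    (Set.mem_image_of_mem S hV'.1) (Set.mem_image_of_mem S hN.1) hstep (hclosest hN)

end Quadratic

section Integrals

variable {α : Type*} [MeasurableSpace α] {μ : Measure α}

lemma integrable_comp_of_ae_mem_isCompact [IsFiniteMeasure μ] {X E : Type*} [TopologicalSpace X]
    [MeasurableSpace X] [OpensMeasurableSpace X] [NormedAddCommGroup E]
    [SecondCountableTopologyEither X E] {K : Set X} (hK : IsCompact K) {Y : α → X}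
    (hY : AEMeasurable Y μ) (hYK : ∀ᵐ a ∂μ, Y a ∈ K) {f : X → E} (hf : Continuous f) :
    Integrable (fun a => f (Y a)) μ := by
  obtain ⟨b, hb⟩ := hK.exists_bound_of_continuousOn hf.continuousOn
  exact Integrable.of_bound (hf.aestronglyMeasurable.comp_aemeasurable hY) b
    (hYK.mono fun a ha => hb (Y a) ha)

variable {ι : Type*} [Fintype ι]

lemma integral_dotProduct_const {u : α → ι → ℝ} (hu : ∀ i, Integrable (fun x => u x i) μ)
    (v : ι → ℝ) : ∫ x, u x ⬝ᵥ v ∂μ = (fun i => ∫ x, u x i ∂μ) ⬝ᵥ v := by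
  simp only [dotProduct]
  rw [integral_finsetSum _ fun i _ => (hu i).mul_const _]
  simp only [integral_mul_const]

lemma integral_dotProduct_mulVec {N : α → Matrix ι ι ℝ}
    (hN : ∀ i j, Integrable (fun x => N x i j) μ) (v : ι → ℝ) :
    ∫ x, v ⬝ᵥ N x *ᵥ v ∂μ = v ⬝ᵥ (Matrix.of fun i j => ∫ x, N x i j ∂μ) *ᵥ v := by
  have hrow (i : ι) : Integrable (fun x => (N x *ᵥ v) i) μ :=
    integrable_finsetSum _ fun j _ => (hN i j).mul_const _
  simp only [dotProduct_comm v]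
  rw [integral_dotProduct_const hrow]
  congr 1
  funext i
  exact integral_dotProduct_const (hN i) v

end Integrals

section Noise

variable {dx : ℕ} {D : Measure (Vec dx)} [IsProbabilityMeasure D] {W σ : ℝ}

lemma NoiseLaw.nonneg (hD : NoiseLaw D W σ) : 0 ≤ W :=
  let ⟨x, hx⟩ := hD.bounded.exists
  (norm_nonneg x).trans hx

lemma NoiseLaw.integrable (hD : NoiseLaw D W σ) {E : Type*} [NormedAddCommGroup E]
    {f : Vec dx → E} (hf : Continuous f) : Integrable f D :=
  integrable_comp_of_ae_mem_isCompact (isCompact_closedBall 0 W) aemeasurable_id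
    (hD.bounded.mono fun _ hx => mem_closedBall_zero_iff.2 hx) hf

lemma NoiseLaw.ae_pi_norm_le (hD : NoiseLaw D W σ) (N : ℕ) :
    ∀ᵐ n ∂(Measure.pi fun _ : Fin N => D), ∀ i, ‖n i‖ ≤ W :=
  ae_all_iff.2 fun i =>
    (measurePreserving_eval (fun _ : Fin N => D) i).quasiMeasurePreserving.ae hD.bounded

lemma NoiseLaw.integrable_pi (hD : NoiseLaw D W σ) {N : ℕ} {f : (Fin N → Vec dx) → ℝ}
    (hf : Continuous f) : Integrable f (Measure.pi fun _ : Fin N => D) :=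
  integrable_comp_of_ae_mem_isCompact (isCompact_univ_pi fun _ => isCompact_closedBall 0 W)
    aemeasurable_id
    ((hD.ae_pi_norm_le N).mono fun _ hn i _ => mem_closedBall_zero_iff.2 (hn i)) hf

lemma NoiseLaw.integral_dotProduct (hD : NoiseLaw D W σ) (c : Fin dx → ℝ) :
    ∫ x, c ⬝ᵥ x.ofLp ∂D = 0 := by
  have hinner (x : Vec dx) : c ⬝ᵥ x.ofLp = inner ℝ (WithLp.toLp 2 c) x := by
    rw [EuclideanSpace.inner_eq_star_dotProduct, star_trivial, dotProduct_comm]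
  have hint : Integrable (fun x => x) D := hD.integrable continuous_id
  simp only [hinner]
  rw [integral_inner hint, hD.centred, inner_zero_right]

lemma NoiseLaw.le_variance (hD : NoiseLaw D W σ) (c : Fin dx → ℝ) :
    σ ^ 2 * (c ⬝ᵥ c) ≤ Var[fun x => c ⬝ᵥ x.ofLp; D] := by
  have hsq (x : Vec dx) :
      (c ⬝ᵥ x.ofLp) ^ 2 = c ⬝ᵥ (Matrix.of fun a b => x a * x b) *ᵥ c := by
    rw [sq, dotProduct, Finset.sum_mul_sum]
    simp only [dotProduct, Matrix.mulVec, Matrix.of_apply, Finset.mul_sum]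
    exact Finset.sum_congr rfl fun a _ => Finset.sum_congr rfl fun b _ => by ring
  have hint (a b : Fin dx) : Integrable (fun x : Vec dx => x a * x b) D :=
    hD.integrable (by fun_prop)
  have hmoment : ∫ x : Vec dx, (c ⬝ᵥ x.ofLp) ^ 2 ∂D
      = c ⬝ᵥ (Matrix.of fun a b => ∫ x : Vec dx, x a * x b ∂D) *ᵥ c := by
    simp only [hsq]
    exact integral_dotProduct_mulVec hint c
  have hcov := hD.covariance.dotProduct_mulVec_nonneg c
  rw [star_trivial, Matrix.sub_mulVec, Matrix.smul_mulVec, Matrix.one_mulVec, dotProduct_sub,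
    dotProduct_smul, smul_eq_mul, sub_nonneg] at hcov
  rwa [variance_of_integral_eq_zero (by fun_prop) (hD.integral_dotProduct c), hmoment]

-- The variances of the independent summands add up to `0`.
lemma NoiseLaw.eq_zero_of_sum_dotProduct_eq_zero (hD : NoiseLaw D W σ) (hσ : 0 < σ) {N : ℕ}
    (c : Fin N → Fin dx → ℝ)
    (hc : ∀ᵐ n ∂(Measure.pi fun _ : Fin N => D), ∑ i, c i ⬝ᵥ (n i).ofLp = 0) (i : Fin N) :
    c i = 0 := by
  have hLp (i : Fin N) : MemLp (fun x : Vec dx => c i ⬝ᵥ x.ofLp) 2 D :=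
    (memLp_two_iff_integrable_sq (by fun_prop)).2 (hD.integrable (by fun_prop))
  have hsum : ∑ i, Var[fun x => c i ⬝ᵥ x.ofLp; D] = 0 := by
    rw [← variance_sum_pi (μ := fun _ => D) hLp, variance_congr (Y := 0), variance_zero]
    filter_upwards [hc] with n hn
    simpa using hn
  have hvar := (Finset.sum_eq_zero_iff_of_nonneg fun i _ => variance_nonneg _ _).1 hsum i
    (Finset.mem_univ i)
  have hle : σ ^ 2 * (c i ⬝ᵥ c i) ≤ 0 := (hD.le_variance (c i)).trans_eq hvar
  have hnonneg : 0 ≤ c i ⬝ᵥ c i := Finset.sum_nonneg fun _ _ => mul_self_nonneg _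
  exact dotProduct_self_eq_zero.1
    (hnonneg.antisymm' (nonpos_of_mul_nonpos_right hle (by positivity)))

end Noise

section Gram

variable {H dx du : ℕ} (A : Matrix (Fin dx) (Fin dx) ℝ) (B : Matrix (Fin dx) (Fin du) ℝ)
  (K₀ : Matrix (Fin du) (Fin dx) ℝ)

lemma sumElim_dotProduct_self {m n : ℕ} (x : Vec m) (y : Vec n) :
    Sum.elim x.ofLp y.ofLp ⬝ᵥ Sum.elim x.ofLp y.ofLp = ‖x‖ ^ 2 + ‖y‖ ^ 2 := by
  rw [sumElim_dotProduct_sumElim, EuclideanSpace.real_norm_sq_eq, EuclideanSpace.real_norm_sq_eq]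
  simp only [dotProduct, sq]

/-- The linear part of the affine map `M ↦ z(M)`. -/
def tangent (n : Fin (2 * H + 1) → Vec dx) : Policy H dx du →ₗ[ℝ] (Fin dx ⊕ Fin du → ℝ) where
  toFun M :=
    let y := steer (A - B * K₀) B (extend n) M
    Sum.elim y.ofLp (input (extend n) M - app K₀ y).ofLp
  map_add' M N := by
    ext (a | a)
    · simp
    · simp [app_add]
      ring
  map_smul' r M := by
    ext (a | a)
    · simp
    · simp [app_smul]
      ring

lemma surrogatePair_sub_surrogatePair (n : Fin (2 * H + 1) → Vec dx) (M N : Policy H dx du) :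
    surrogatePair A B K₀ M n - surrogatePair A B K₀ N n = tangent A B K₀ n (M - N) := by
  have haction : surrogateAction A B K₀ M n - surrogateAction A B K₀ N n
      = input (extend n) (M - N) - app K₀ (steer (A - B * K₀) B (extend n) (M - N)) := by
    rw [surrogateAction_eq, surrogateAction_eq, ← response_sub_response, app_sub, map_sub]
    abel
  ext (a | a)
  · simp [surrogatePair, tangent, surrogateState_eq, ← response_sub_response]
  · simpa [surrogatePair, tangent] using congrArg (fun x : Vec du => x a) haction

lemma jacobian_mulVec (n : Fin (2 * H + 1) → Vec dx) (V : Policy H dx du) :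
    jacobian A B K₀ n *ᵥ V.ofLp = tangent A B K₀ n V := by
  have hV : V = ∑ p, V p • (EuclideanSpace.single p 1 : Policy H dx du) := by
    ext q
    simp [Finset.sum_apply, Pi.single_apply]
  have hcol (ρ p) : jacobian A B K₀ n ρ p
      = tangent A B K₀ n (EuclideanSpace.single p 1 : Policy H dx du) ρ := by
    rw [jacobian, Matrix.of_apply, ← Pi.sub_apply, surrogatePair_sub_surrogatePair, sub_zero]
  conv_rhs => rw [hV, map_sum]
  ext ρ
  simp [Matrix.mulVec, dotProduct, hcol, mul_comm]

lemma surrogatePair_dotProduct_self (n : Fin (2 * H + 1) → Vec dx) (V : Policy H dx du) :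
    surrogatePair A B K₀ V n ⬝ᵥ surrogatePair A B K₀ V n
      = ‖surrogateState A B K₀ V n‖ ^ 2 + ‖surrogateAction A B K₀ V n‖ ^ 2 :=
  sumElim_dotProduct_self _ _

lemma surrogatePair_dotProduct_self_eq_add (n : Fin (2 * H + 1) → Vec dx) (V : Policy H dx du) :
    surrogatePair A B K₀ V n ⬝ᵥ surrogatePair A B K₀ V n
      = surrogatePair A B K₀ (0 : Policy H dx du) n ⬝ᵥ surrogatePair A B K₀ 0 n
        + 2 * ((surrogatePair A B K₀ (0 : Policy H dx du) n ᵥ* jacobian A B K₀ n) ⬝ᵥ V.ofLp)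
        + tangent A B K₀ n V ⬝ᵥ tangent A B K₀ n V := by
  have h := surrogatePair_sub_surrogatePair A B K₀ n V 0
  rw [sub_zero] at h
  rw [← Matrix.dotProduct_mulVec, jacobian_mulVec, sub_eq_iff_eq_add'.1 h, add_dotProduct,
    dotProduct_add, dotProduct_add, dotProduct_comm (tangent A B K₀ n V) (surrogatePair A B K₀ 0 n)]
  ring

@[fun_prop]
lemma continuous_surrogatePair (V : Policy H dx du) :
    Continuous fun n => surrogatePair A B K₀ V n := by
  have hy := (continuous_response (A - B * K₀) B V).comp (continuous_extend (N := 2 * H + 1))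
  have hv := (continuous_app (continuous_const (y := K₀)) hy).neg.add
    ((continuous_input V).comp continuous_extend)
  refine continuous_pi fun ρ => ?_
  simp only [surrogatePair, surrogateState_eq, surrogateAction_eq]
  rcases ρ with a | a
  · exact (EuclideanSpace.proj a).continuous.comp hy
  · exact (EuclideanSpace.proj a).continuous.comp hv

@[fun_prop]
lemma continuous_jacobian :
    Continuous fun n : Fin (2 * H + 1) → Vec dx => jacobian A B K₀ n :=
  continuous_matrix fun ρ _ => (continuous_apply ρ).comp
    ((continuous_surrogatePair A B K₀ _).sub (continuous_surrogatePair A B K₀ _))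

lemma continuous_tangent_dotProduct_self (V : Policy H dx du) :
    Continuous fun n => tangent A B K₀ n V ⬝ᵥ tangent A B K₀ n V := by
  simp only [← jacobian_mulVec]
  fun_prop

/-- The surrogate cost for the running cost `‖x‖² + ‖u‖²`. -/
def meanSquare (D : Measure (Vec dx)) (M : Policy H dx du) : ℝ :=
  surrogateCost A B K₀ D (fun x u => ‖x‖ ^ 2 + ‖u‖ ^ 2) M

lemma isHermitian_gram (D : Measure (Vec dx)) : (gram H A B K₀ D).IsHermitian := by
  ext p q
  simp only [Matrix.conjTranspose_apply, star_trivial, gram, Matrix.of_apply, Matrix.mul_apply,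
    Matrix.transpose_apply, mul_comm]

lemma continuous_norm_input_sq {N : ℕ} (V : Policy H dx du) :
    Continuous fun n : Fin N → Vec dx => ‖input (extend n) V‖ ^ 2 :=
  ((continuous_input V).comp continuous_extend).norm.pow 2

variable {D : Measure (Vec dx)} [IsProbabilityMeasure D] {W σ : ℝ} (hD : NoiseLaw D W σ)
include hD

lemma sqNorm_gram (V : Policy H dx du) :
    sqNorm (gram H A B K₀ D) V
      = ∫ n, tangent A B K₀ n V ⬝ᵥ tangent A B K₀ n V
          ∂(Measure.pi fun _ : Fin (2 * H + 1) => D) := by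
  have hint (p q : Fin H × Fin du × Fin dx) :
      Integrable (fun n => ((jacobian A B K₀ n)ᵀ * jacobian A B K₀ n) p q)
        (Measure.pi fun _ : Fin (2 * H + 1) => D) :=
    hD.integrable_pi (((continuous_jacobian A B K₀).matrix_transpose.matrix_mul
      (continuous_jacobian A B K₀)).matrix_elem p q)
  have hquad (n : Fin (2 * H + 1) → Vec dx) : tangent A B K₀ n V ⬝ᵥ tangent A B K₀ n V
      = V.ofLp ⬝ᵥ ((jacobian A B K₀ n)ᵀ * jacobian A B K₀ n) *ᵥ V.ofLp := by
    rw [← jacobian_mulVec, Matrix.dotProduct_mulVec, ← Matrix.mulVec_transpose,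
      Matrix.mulVec_mulVec, dotProduct_comm]
  simp only [hquad]
  exact (integral_dotProduct_mulVec hint V.ofLp).symm

lemma exists_meanSquare_eq : ∃ (c₀ : ℝ) (b : Fin H × Fin du × Fin dx → ℝ), ∀ V : Policy H dx du,
    meanSquare A B K₀ D V = c₀ + 2 * (b ⬝ᵥ V.ofLp) + sqNorm (gram H A B K₀ D) V := by
  let z₀ (n : Fin (2 * H + 1) → Vec dx) := surrogatePair A B K₀ (0 : Policy H dx du) n
  have hcross (p : Fin H × Fin du × Fin dx) :
      Continuous fun n => (z₀ n ᵥ* jacobian A B K₀ n) p := by fun_prop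
  refine ⟨∫ n, z₀ n ⬝ᵥ z₀ n ∂(Measure.pi fun _ => D),
    fun p => ∫ n, (z₀ n ᵥ* jacobian A B K₀ n) p ∂(Measure.pi fun _ => D), fun V => ?_⟩
  rw [sqNorm_gram A B K₀ hD, ← integral_dotProduct_const
    fun p => hD.integrable_pi (hcross p), ← integral_const_mul,
    ← integral_add, ← integral_add]
  · simp only [meanSquare, surrogateCost, ← surrogatePair_dotProduct_self,
      surrogatePair_dotProduct_self_eq_add A B K₀ _ V, z₀]
  · exact hD.integrable_pi (by fun_prop)
  · exact hD.integrable_pi (continuous_tangent_dotProduct_self A B K₀ V)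
  · exact hD.integrable_pi (by fun_prop)
  · exact hD.integrable_pi (by fun_prop)

-- The disturbance action is `v + K₀ y`, where `(y, v)` is the image under the Jacobian.
lemma integral_norm_input_sq_le (V : Policy H dx du) :
    ∫ n, ‖input (extend n) V‖ ^ 2 ∂(Measure.pi fun _ : Fin (2 * H + 1) => D)
      ≤ (1 + ‖K₀‖ ^ 2) * sqNorm (gram H A B K₀ D) V := by
  rw [sqNorm_gram A B K₀ hD, ← integral_const_mul]
  refine integral_mono
    (hD.integrable_pi (continuous_norm_input_sq V))
    (hD.integrable_pi ((continuous_tangent_dotProduct_self A B K₀ V).const_mul _)) fun n => ?_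
  let y := steer (A - B * K₀) B (extend n) V
  let v := input (extend n) V - app K₀ y
  have htangent : tangent A B K₀ n V ⬝ᵥ tangent A B K₀ n V = ‖y‖ ^ 2 + ‖v‖ ^ 2 :=
    sumElim_dotProduct_self y v
  have hinput : ‖input (extend n) V‖ ≤ ‖v‖ + ‖K₀‖ * ‖y‖ :=
    calc ‖input (extend n) V‖ = ‖v + app K₀ y‖ := by rw [sub_add_cancel]
      _ ≤ ‖v‖ + ‖K₀‖ * ‖y‖ := (norm_add_le _ _).trans (by gcongr; exact norm_app_le K₀ y)
  calc ‖input (extend n) V‖ ^ 2 ≤ (‖v‖ + ‖K₀‖ * ‖y‖) ^ 2 :=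
        pow_le_pow_left₀ (norm_nonneg _) hinput 2
    _ ≤ (1 + ‖K₀‖ ^ 2) * (‖y‖ ^ 2 + ‖v‖ ^ 2) := by nlinarith [sq_nonneg (‖y‖ - ‖K₀‖ * ‖v‖)]
    _ = (1 + ‖K₀‖ ^ 2) * (tangent A B K₀ n V ⬝ᵥ tangent A B K₀ n V) := by rw [htangent]

lemma eq_zero_of_input_eq_zero (hσ : 0 < σ) {V : Policy H dx du}
    (hV : ∀ᵐ n ∂(Measure.pi fun _ : Fin (2 * H + 1) => D), input (extend n) V = 0) : V = 0 := by
  have hsum (n : Fin (2 * H + 1) → Vec dx) :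
      input (extend n) V = ∑ i : Fin (2 * H + 1), app (block V i) (n i) := by
    rw [sum_fin_eq_sum_extend fun i => app (block V i), input_apply]
    refine Finset.sum_subset (Finset.range_mono (by lia)) fun i _ hi => ?_
    rw [block_of_le (by simpa using hi), zero_app]
  have hrow (a : Fin du) (i : Fin (2 * H + 1)) : block V i a = 0 := by
    refine hD.eq_zero_of_sum_dotProduct_eq_zero hσ (fun i => block V i a) ?_ i
    filter_upwards [hV] with n hn
    simpa [hsum, app_ofLp, Matrix.mulVec] using congrArg (fun x : Vec du => x a) hn
  ext p
  rw [← block_apply V p]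
  exact congrFun (hrow p.2.1 ⟨p.1, by lia⟩) p.2.2

lemma gram_posDef (hσ : 0 < σ) : (gram H A B K₀ D).PosDef := by
  refine Matrix.PosDef.of_dotProduct_mulVec_pos (isHermitian_gram A B K₀ D) fun x hx => ?_
  let V : Policy H dx du := WithLp.toLp 2 x
  rw [star_trivial]
  change 0 < sqNorm (gram H A B K₀ D) V
  by_contra! hneg
  have hzero : ∫ n, ‖input (extend n) V‖ ^ 2 ∂(Measure.pi fun _ : Fin (2 * H + 1) => D) = 0 :=
    ((integral_norm_input_sq_le A B K₀ hD V).trans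
      (mul_nonpos_of_nonneg_of_nonpos (by positivity) hneg)).antisymm
        (integral_nonneg fun n => sq_nonneg _)
  rw [integral_eq_zero_iff_of_nonneg (fun n => sq_nonneg _)
    (hD.integrable_pi (continuous_norm_input_sq V))] at hzero
  have hV : V = 0 := eq_zero_of_input_eq_zero hD hσ (hzero.mono fun n hn => by simpa using hn)
  exact hx (congrArg WithLp.ofLp hV)

end Gram

section System

variable {H dx du : ℕ}

/-- The standing assumptions on the system, the stabilising controller and the constants. -/
structure StableSystem (A : Matrix (Fin dx) (Fin dx) ℝ) (B : Matrix (Fin dx) (Fin du) ℝ)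
    (K₀ : Matrix (Fin du) (Fin dx) ℝ) (κ γ κB : ℝ) : Prop where
  one_le : 1 ≤ κ
  pos : 0 < γ
  lt_one : γ < 1
  norm_le : ‖B‖ ≤ κB
  two_le : 2 ≤ κB * (1 - γ)
  stable : DiagStronglyStable A B κ γ K₀

/-- The constant whose powers bound states, actions and costs. -/
def scale (κ γ κB : ℝ) : ℝ := κ * κB * γ⁻¹

/-- The state and the action at time `t` along the noise sequence `w`. -/
def trajectory (A : Matrix (Fin dx) (Fin dx) ℝ) (B : Matrix (Fin dx) (Fin du) ℝ)
    (ctrl : ℕ → Vec dx → Vec du) (w : ℕ → Vec dx) (t : ℕ) : Vec dx × Vec du :=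
  (state A B ctrl w t, ctrl t (state A B ctrl w t))

/-- The part of the action that remains after the stabilising feedback `-K₀ x`. -/
def residual (A : Matrix (Fin dx) (Fin dx) ℝ) (B : Matrix (Fin dx) (Fin du) ℝ)
    (K₀ : Matrix (Fin du) (Fin dx) ℝ) (ctrl : ℕ → Vec dx → Vec du) (w : ℕ → Vec dx) (t : ℕ) :
    Vec du :=
  ctrl t (state A B ctrl w t) + app K₀ (state A B ctrl w t)

/-- The cost of the first `T` steps along the noise sequence `w`. -/
def totalCost (A : Matrix (Fin dx) (Fin dx) ℝ) (B : Matrix (Fin dx) (Fin du) ℝ) (r : ℕ → ℝ) (T : ℕ)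
    (ctrl : ℕ → Vec dx → Vec du) (w : ℕ → Vec dx) : ℝ :=
  ∑ t ∈ Finset.Icc 1 T, sphericalCost r t (trajectory A B ctrl w t).1 (trajectory A B ctrl w t).2

/-- The surrogate state and action of the policy `M`, driven by a noise sequence `n`, in which only
the noises of age at most `2H` enter. -/
def surrogateResponse (A : Matrix (Fin dx) (Fin dx) ℝ) (B : Matrix (Fin dx) (Fin du) ℝ)
    (K₀ : Matrix (Fin du) (Fin dx) ℝ) (M : Policy H dx du) (n : ℕ → Vec dx) : Vec dx × Vec du :=
  (response (A - B * K₀) B n M, -app K₀ (response (A - B * K₀) B n M) + input n M)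

/-- The disturbance-action policy whose actions on top of `-K₀ x` are those of the linear
controller `K`, up to truncation of the past. -/
def imitation (H : ℕ) (A : Matrix (Fin dx) (Fin dx) ℝ) (B : Matrix (Fin dx) (Fin du) ℝ)
    (K₀ K : Matrix (Fin du) (Fin dx) ℝ) : Policy H dx du :=
  ofBlocks H fun i => (K₀ - K) * (A - B * K) ^ i

section Costs

variable {r : ℕ → ℝ} {t : ℕ} {β b : ℝ} {p q : Vec dx × Vec du}

lemma sphericalCost_mem_Icc (hr : r t ∈ Set.Icc 0 β) (hp : ‖p‖ ≤ b) :
    sphericalCost r t p.1 p.2 ∈ Set.Icc 0 (β * (2 * b ^ 2)) := by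
  have hsq : ‖p.1‖ ^ 2 + ‖p.2‖ ^ 2 ≤ 2 * b ^ 2 := by
    rw [two_mul]
    gcongr
    exacts [(norm_fst_le p).trans hp, (norm_snd_le p).trans hp]
  exact ⟨mul_nonneg hr.1 (by positivity),
    mul_le_mul hr.2 hsq (by positivity) (hr.1.trans hr.2)⟩

lemma abs_norm_sq_sub_norm_sq_le {E : Type*} [SeminormedAddCommGroup E] {x y : E} (hx : ‖x‖ ≤ b)
    (hy : ‖y‖ ≤ b) : |‖x‖ ^ 2 - ‖y‖ ^ 2| ≤ 2 * b * ‖x - y‖ := by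
  rw [sq_sub_sq, abs_mul, abs_of_nonneg (by positivity)]
  exact mul_le_mul (by linarith) (abs_norm_sub_norm_le x y) (abs_nonneg _)
    (by linarith [norm_nonneg x])

lemma abs_sphericalCost_sub_le (hr : r t ∈ Set.Icc 0 β) (hp : ‖p‖ ≤ b) (hq : ‖q‖ ≤ b) :
    |sphericalCost r t p.1 p.2 - sphericalCost r t q.1 q.2|
      ≤ β * (2 * b) * (‖p.1 - q.1‖ + ‖p.2 - q.2‖) := by
  have hstate := abs_norm_sq_sub_norm_sq_le ((norm_fst_le p).trans hp) ((norm_fst_le q).trans hq)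
  have haction := abs_norm_sq_sub_norm_sq_le ((norm_snd_le p).trans hp) ((norm_snd_le q).trans hq)
  rw [sphericalCost, sphericalCost, ← mul_sub, add_sub_add_comm, abs_mul, abs_of_nonneg hr.1,
    mul_assoc, mul_add]
  exact mul_le_mul hr.2 ((abs_add_le _ _).trans (add_le_add hstate haction)) (abs_nonneg _)
    (hr.1.trans hr.2)

end Costs

variable {A : Matrix (Fin dx) (Fin dx) ℝ} {B : Matrix (Fin dx) (Fin du) ℝ}
  {K₀ K : Matrix (Fin du) (Fin dx) ℝ} {κ γ κB W : ℝ}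

lemma residual_policyCtrl (M : ℕ → Policy H dx du) (w : ℕ → Vec dx) (t : ℕ) :
    residual A B K₀ (policyCtrl K₀ M w) w t = input (history w t) (M t) := by
  rw [residual, policyCtrl_eq, neg_add_cancel_comm]

lemma residual_linearCtrl (w : ℕ → Vec dx) (t : ℕ) :
    residual A B K₀ (linearCtrl K w) w t = app (K₀ - K) (state A B (linearCtrl K w) w t) := by
  rw [residual, linearCtrl, sub_app, neg_add_eq_sub]

namespace StableSystem

variable (h : StableSystem A B K₀ κ γ κB)
include h

section Scale

lemma two_le_bound : 2 ≤ κB := by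
  nlinarith [h.pos, h.lt_one, h.two_le]

lemma one_le_inv : 1 ≤ γ⁻¹ := (one_le_inv₀ h.pos).2 h.lt_one.le

lemma two_mul_mul_inv_le_scale : 2 * κ * γ⁻¹ ≤ scale κ γ κB := by
  rw [scale, mul_comm 2]
  have := h.one_le
  have := h.one_le_inv
  gcongr
  exact h.two_le_bound

lemma bound_le_scale : κB ≤ scale κ γ κB := by
  have := h.one_le
  have := h.two_le_bound
  calc κB = 1 * κB * 1 := by ring
    _ ≤ scale κ γ κB := by
        unfold scale
        gcongr
        exact h.one_le_inv

lemma two_le_scale : 2 ≤ scale κ γ κB := h.two_le_bound.trans h.bound_le_scale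

lemma two_mul_le_scale : 2 * κ ≤ scale κ γ κB :=
  (le_mul_of_one_le_right (by linarith [h.one_le]) h.one_le_inv).trans h.two_mul_mul_inv_le_scale

lemma le_scale : κ ≤ scale κ γ κB := by linarith [h.one_le, h.two_mul_le_scale]

lemma pow_mul_le_pow_mul (hW : 0 ≤ W) {m n : ℕ} (hmn : m ≤ n) :
    scale κ γ κB ^ m * W ≤ scale κ γ κB ^ n * W :=
  mul_le_mul_of_nonneg_right (pow_le_pow_right₀ (by linarith [h.two_le_scale]) hmn) hW

lemma pow_add_one_le (n : ℕ) : scale κ γ κB ^ n + 1 ≤ scale κ γ κB ^ (n + 1) := by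
  have hscale := h.two_le_scale
  have hpow : 1 ≤ scale κ γ κB ^ n := one_le_pow₀ (by linarith)
  rw [pow_succ]
  nlinarith

lemma policy_bound_le : κ ^ 3 * κB * γ⁻¹ ≤ scale κ γ κB ^ 3 := by
  have := h.one_le
  have := h.two_le_scale
  calc κ ^ 3 * κB * γ⁻¹ = κ ^ 2 * scale κ γ κB := by
        unfold scale
        ring
    _ ≤ scale κ γ κB ^ 2 * scale κ γ κB := by
        gcongr
        exact h.le_scale
    _ = scale κ γ κB ^ 3 := by ring

lemma sq_mul_inv_le : κ ^ 2 * γ⁻¹ ≤ scale κ γ κB ^ 2 := by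
  have := h.one_le
  have hinv := h.one_le_inv
  have hκγ : κ * γ⁻¹ ≤ scale κ γ κB := by
    nlinarith [h.two_mul_mul_inv_le_scale]
  calc κ ^ 2 * γ⁻¹ = κ * (κ * γ⁻¹) := by ring
    _ ≤ scale κ γ κB * scale κ γ κB :=
        mul_le_mul h.le_scale hκγ (by positivity) (by linarith [h.two_le_scale])
    _ = scale κ γ κB ^ 2 := by ring

lemma response_bound_le (hW : 0 ≤ W) :
    κ ^ 2 * (κB * (scale κ γ κB ^ 3 * W) + W) * γ⁻¹ ≤ scale κ γ κB ^ 7 * W := by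
  have := h.two_le_bound
  have := h.two_le_scale
  have hdrift : κB * scale κ γ κB ^ 3 + 1 ≤ scale κ γ κB ^ 5 :=
    calc κB * scale κ γ κB ^ 3 + 1 ≤ scale κ γ κB ^ 4 + 1 := by
          rw [pow_succ' _ 3]
          gcongr
          exact h.bound_le_scale
      _ ≤ scale κ γ κB ^ 5 := h.pow_add_one_le 4
  calc κ ^ 2 * (κB * (scale κ γ κB ^ 3 * W) + W) * γ⁻¹
      = (κ ^ 2 * γ⁻¹) * (κB * scale κ γ κB ^ 3 + 1) * W := by ring
    _ ≤ scale κ γ κB ^ 2 * scale κ γ κB ^ 5 * W := by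
        gcongr
        exact h.sq_mul_inv_le
    _ = scale κ γ κB ^ 7 * W := by ring

lemma comparison_bound_le : (1 + κ) * (κ ^ 2 * γ⁻¹ * κB) + 1 ≤ scale κ γ κB ^ 5 := by
  have := h.one_le
  have := h.two_le_scale
  have hsum : 1 + κ ≤ scale κ γ κB := by linarith [h.two_mul_le_scale]
  calc (1 + κ) * (κ ^ 2 * γ⁻¹ * κB) + 1 = (1 + κ) * (κ * scale κ γ κB) + 1 := by
        unfold scale
        ring
    _ ≤ scale κ γ κB * (scale κ γ κB * scale κ γ κB) + 1 := by
        gcongr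
        exact h.le_scale
    _ = scale κ γ κB ^ 3 + 1 := by ring
    _ ≤ scale κ γ κB ^ 4 := h.pow_add_one_le 3
    _ ≤ scale κ γ κB ^ 5 := pow_le_pow_right₀ (by linarith) (by norm_num)

end Scale

section Bounds

lemma norm_prodMk_le (hW : 0 ≤ W) {x : Vec dx} {a : Vec du} (hx : ‖x‖ ≤ scale κ γ κB ^ 7 * W)
    (ha : ‖a‖ ≤ scale κ γ κB ^ 3 * W) : ‖(x, -app K₀ x + a)‖ ≤ scale κ γ κB ^ 9 * W := by
  refine max_le (hx.trans (h.pow_mul_le_pow_mul hW (by norm_num))) ?_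
  have hfeedback : ‖-app K₀ x‖ ≤ scale κ γ κB ^ 8 * W := by
    rw [norm_neg]
    exact (norm_app_le_of_le (h.stable.norm_le.trans h.le_scale) hx).trans_eq (by ring)
  calc ‖-app K₀ x + a‖ ≤ scale κ γ κB ^ 8 * W + scale κ γ κB ^ 8 * W :=
        norm_add_le_of_le hfeedback (ha.trans (h.pow_mul_le_pow_mul hW (by norm_num)))
    _ = 2 * (scale κ γ κB ^ 8 * W) := (two_mul _).symm
    _ ≤ scale κ γ κB * (scale κ γ κB ^ 8 * W) :=
        mul_le_mul_of_nonneg_right h.two_le_scale ((norm_nonneg _).trans hfeedback)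
    _ = scale κ γ κB ^ 9 * W := by ring

lemma norm_input_le {M : Policy H dx du} (hM : M ∈ policySet H dx du κ κB γ) {n : ℕ → Vec dx}
    (hn : ∀ i, ‖n i‖ ≤ W) : ‖input n M‖ ≤ scale κ γ κB ^ 3 * W := by
  have := h.one_le
  have := h.two_le_bound
  exact (OnlineControl.norm_input_le h.pos h.lt_one (by positivity) hM hn).trans
    (mul_le_mul_of_nonneg_right h.policy_bound_le ((norm_nonneg _).trans (hn 0)))

lemma norm_contribution_le {M : Policy H dx du} (hM : M ∈ policySet H dx du κ κB γ)
    {n : ℕ → Vec dx} (hn : ∀ i, ‖n i‖ ≤ W) (j : ℕ) :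
    ‖contribution (A - B * K₀) B n M j‖
      ≤ κ ^ 2 * (κB * (scale κ γ κB ^ 3 * W) + W) * (1 - γ) ^ j :=
  OnlineControl.norm_contribution_le h.stable.norm_pow_le h.norm_le hn
    (fun _ => h.norm_input_le hM fun _ => hn _) j

lemma norm_response_le {M : Policy H dx du} (hM : M ∈ policySet H dx du κ κB γ) {n : ℕ → Vec dx}
    (hn : ∀ i, ‖n i‖ ≤ W) : ‖response (A - B * K₀) B n M‖ ≤ scale κ γ κB ^ 7 * W := by
  have hW : 0 ≤ W := (norm_nonneg _).trans (hn 0)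
  have := h.two_le_bound
  have := h.two_le_scale
  exact (norm_sum_range_le_geometric h.pos h.lt_one (by positivity)
    fun j _ => h.norm_contribution_le hM hn j).trans (h.response_bound_le hW)

lemma norm_surrogateResponse_le {M : Policy H dx du} (hM : M ∈ policySet H dx du κ κB γ)
    {n : ℕ → Vec dx} (hn : ∀ i, ‖n i‖ ≤ W) :
    ‖surrogateResponse A B K₀ M n‖ ≤ scale κ γ κB ^ 9 * W :=
  h.norm_prodMk_le ((norm_nonneg _).trans (hn 0)) (h.norm_response_le hM hn)
    (h.norm_input_le hM hn)

variable {w : ℕ → Vec dx} (hw : ∀ s, ‖w s‖ ≤ W) {t : ℕ}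
include hw

lemma norm_state_policyCtrl_le {M : ℕ → Policy H dx du}
    (hM : ∀ s ∈ Finset.Icc 1 t, M s ∈ policySet H dx du κ κB γ) :
    ‖state A B (policyCtrl K₀ M w) w (t + 1)‖ ≤ scale κ γ κB ^ 7 * W := by
  have hW : 0 ≤ W := (norm_nonneg _).trans (hw 0)
  have := h.two_le_bound
  have := h.two_le_scale
  refine (norm_le_of_recursion (z := fun t => state A B (policyCtrl K₀ M w) w (t + 1))
    (e := fun t => app B (input (history w t) (M t)) + w t) h.pos h.lt_one (sq_nonneg κ)
    h.stable.norm_pow_le (state_one A B w _) (state_policyCtrl_add_two A B K₀ w M)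
    (b := κB * (scale κ γ κB ^ 3 * W) + W) (by positivity) fun s hs => ?_).trans
    (h.response_bound_le hW)
  exact norm_add_le_of_le (norm_app_le_of_le h.norm_le
    (h.norm_input_le (hM (s + 1) (Finset.mem_Icc.2 ⟨by lia, hs⟩)) (norm_history_le hw _))) (hw _)

lemma norm_trajectory_policyCtrl_le {M : ℕ → Policy H dx du} (ht : 1 ≤ t)
    (hM : ∀ s ∈ Finset.Icc 1 t, M s ∈ policySet H dx du κ κB γ) :
    ‖trajectory A B (policyCtrl K₀ M w) w t‖ ≤ scale κ γ κB ^ 9 * W := by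
  rw [trajectory, policyCtrl_eq]
  refine h.norm_prodMk_le ((norm_nonneg _).trans (hw 0)) ?_
    (h.norm_input_le (hM t (Finset.right_mem_Icc.2 ht)) (norm_history_le hw t))
  obtain ⟨t, rfl⟩ := Nat.exists_eq_add_of_le' ht
  exact h.norm_state_policyCtrl_le hw fun s hs => hM s (Finset.Icc_subset_Icc_right t.le_succ hs)

lemma norm_trajectory_linearCtrl_le (hK : DiagStronglyStable A B κ γ K) (ht : 1 ≤ t) :
    ‖trajectory A B (linearCtrl K w) w t‖ ≤ scale κ γ κB ^ 9 * W := by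
  have hW : 0 ≤ W := (norm_nonneg _).trans (hw 0)
  obtain ⟨t, rfl⟩ := Nat.exists_eq_add_of_le' ht
  have hstate : ‖state A B (linearCtrl K w) w (t + 1)‖ ≤ scale κ γ κB ^ 2 * W :=
    calc ‖state A B (linearCtrl K w) w (t + 1)‖ ≤ κ ^ 2 * W * γ⁻¹ :=
          norm_le_of_recursion (z := fun t => state A B (linearCtrl K w) w (t + 1)) (e := w) h.pos
            h.lt_one (sq_nonneg κ) hK.norm_pow_le (state_one A B w _)
            (state_linearCtrl_add_two A B K w) hW fun s _ => hw _
      _ = κ ^ 2 * γ⁻¹ * W := by ring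
      _ ≤ scale κ γ κB ^ 2 * W := mul_le_mul_of_nonneg_right h.sq_mul_inv_le hW
  refine max_le (hstate.trans (h.pow_mul_le_pow_mul hW (by norm_num))) ?_
  calc ‖-app K (state A B (linearCtrl K w) w (t + 1))‖
      ≤ scale κ γ κB * (scale κ γ κB ^ 2 * W) := by
        rw [norm_neg]
        exact norm_app_le_of_le (hK.norm_le.trans h.le_scale) hstate
    _ = scale κ γ κB ^ 3 * W := by ring
    _ ≤ scale κ γ κB ^ 9 * W := h.pow_mul_le_pow_mul hW (by norm_num)

end Bounds

section Comparison

lemma sum_norm_state_sub_le (ctrl ctrl' : ℕ → Vec dx → Vec du) (w : ℕ → Vec dx) (T : ℕ) :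
    ∑ t ∈ Finset.Icc 1 T, ‖state A B ctrl w t - state A B ctrl' w t‖
      ≤ κ ^ 2 * γ⁻¹ * κB * ∑ t ∈ Finset.Icc 1 T,
        ‖residual A B K₀ ctrl w t - residual A B K₀ ctrl' w t‖ := by
  have := h.one_le_inv
  have hrec (t : ℕ) : state A B ctrl w (t + 1 + 1) - state A B ctrl' w (t + 1 + 1)
      = app (A - B * K₀) (state A B ctrl w (t + 1) - state A B ctrl' w (t + 1))
        + app B (residual A B K₀ ctrl w (t + 1) - residual A B K₀ ctrl' w (t + 1)) := by
    rw [state_add_two A B K₀, state_add_two A B K₀, app_sub, app_sub, residual, residual]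
    abel
  have hsum := sum_norm_le_of_recursion
    (z := fun t => state A B ctrl w (t + 1) - state A B ctrl' w (t + 1))
    (e := fun t => app B (residual A B K₀ ctrl w t - residual A B K₀ ctrl' w t))
    h.pos h.lt_one (sq_nonneg κ) h.stable.norm_pow_le (sub_self 0) hrec T
  rw [sum_Icc_one_eq_sum_range, sum_Icc_one_eq_sum_range, mul_assoc, Finset.mul_sum _ _ κB]
  exact hsum.trans (mul_le_mul_of_nonneg_left
    (Finset.sum_le_sum fun t _ => norm_app_le_of_le h.norm_le le_rfl) (by positivity))

lemma sum_norm_trajectory_sub_le (ctrl ctrl' : ℕ → Vec dx → Vec du) (w : ℕ → Vec dx) (T : ℕ) :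
    ∑ t ∈ Finset.Icc 1 T, (‖(trajectory A B ctrl w t).1 - (trajectory A B ctrl' w t).1‖
        + ‖(trajectory A B ctrl w t).2 - (trajectory A B ctrl' w t).2‖)
      ≤ scale κ γ κB ^ 5 * ∑ t ∈ Finset.Icc 1 T,
        ‖residual A B K₀ ctrl w t - residual A B K₀ ctrl' w t‖ := by
  have := h.one_le
  let x (t : ℕ) := state A B ctrl w t - state A B ctrl' w t
  let a (t : ℕ) := residual A B K₀ ctrl w t - residual A B K₀ ctrl' w t
  have haction (t : ℕ) : ‖(trajectory A B ctrl w t).2 - (trajectory A B ctrl' w t).2‖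
      ≤ ‖a t‖ + κ * ‖x t‖ := by
    have heq : (trajectory A B ctrl w t).2 - (trajectory A B ctrl' w t).2
        = a t - app K₀ (x t) := by
      simp only [trajectory, residual, app_sub, a, x]
      abel
    rw [heq]
    exact norm_sub_le_of_le le_rfl (norm_app_le_of_le h.stable.norm_le le_rfl)
  calc ∑ t ∈ Finset.Icc 1 T, (‖(trajectory A B ctrl w t).1 - (trajectory A B ctrl' w t).1‖
        + ‖(trajectory A B ctrl w t).2 - (trajectory A B ctrl' w t).2‖)
      ≤ ∑ t ∈ Finset.Icc 1 T, ((1 + κ) * ‖x t‖ + ‖a t‖) :=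
        Finset.sum_le_sum fun t _ => (add_le_add_right (haction t) ‖x t‖).trans_eq (by ring)
    _ = (1 + κ) * ∑ t ∈ Finset.Icc 1 T, ‖x t‖ + ∑ t ∈ Finset.Icc 1 T, ‖a t‖ := by
        rw [Finset.sum_add_distrib, ← Finset.mul_sum]
    _ ≤ (1 + κ) * (κ ^ 2 * γ⁻¹ * κB * ∑ t ∈ Finset.Icc 1 T, ‖a t‖)
          + ∑ t ∈ Finset.Icc 1 T, ‖a t‖ := by
        gcongr
        exact h.sum_norm_state_sub_le ctrl ctrl' w T
    _ = ((1 + κ) * (κ ^ 2 * γ⁻¹ * κB) + 1) * ∑ t ∈ Finset.Icc 1 T, ‖a t‖ := by ring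
    _ ≤ scale κ γ κB ^ 5 * ∑ t ∈ Finset.Icc 1 T, ‖a t‖ := by
        gcongr
        exact h.comparison_bound_le

lemma abs_totalCost_sub_le {r : ℕ → ℝ} {β b : ℝ} {T : ℕ} (hβ : 0 ≤ β) (hb : 0 ≤ b)
    (hr : ∀ t ∈ Finset.Icc 1 T, r t ∈ Set.Icc 0 β) {ctrl ctrl' : ℕ → Vec dx → Vec du}
    {w : ℕ → Vec dx} (hctrl : ∀ t ∈ Finset.Icc 1 T, ‖trajectory A B ctrl w t‖ ≤ b)
    (hctrl' : ∀ t ∈ Finset.Icc 1 T, ‖trajectory A B ctrl' w t‖ ≤ b) :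
    |totalCost A B r T ctrl w - totalCost A B r T ctrl' w|
      ≤ β * (2 * b) * (scale κ γ κB ^ 5 * ∑ t ∈ Finset.Icc 1 T,
        ‖residual A B K₀ ctrl w t - residual A B K₀ ctrl' w t‖) := by
  rw [totalCost, totalCost, ← Finset.sum_sub_distrib]
  refine (Finset.abs_sum_le_sum_abs _ _).trans ((Finset.sum_le_sum fun t ht =>
    abs_sphericalCost_sub_le (hr t ht) (hctrl t ht) (hctrl' t ht)).trans ?_)
  rw [← Finset.mul_sum]
  exact mul_le_mul_of_nonneg_left (h.sum_norm_trajectory_sub_le ctrl ctrl' w T) (by positivity)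

end Comparison

section Truncation

lemma norm_imitation_le (hK : DiagStronglyStable A B κ γ K) (i : ℕ) :
    ‖(K₀ - K) * (A - B * K) ^ i‖ ≤ 2 * κ ^ 3 * (1 - γ) ^ i := by
  have := h.one_le
  have hsub : ‖K₀ - K‖ ≤ 2 * κ :=
    (norm_sub_le_of_le h.stable.norm_le hK.norm_le).trans_eq (two_mul κ).symm
  calc ‖(K₀ - K) * (A - B * K) ^ i‖ ≤ 2 * κ * (κ ^ 2 * (1 - γ) ^ i) :=
        (Matrix.l2_opNorm_mul _ _).trans
          (mul_le_mul hsub (hK.norm_pow_le i) (norm_nonneg _) (by positivity))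
    _ = 2 * κ ^ 3 * (1 - γ) ^ i := by ring

lemma imitation_mem (H : ℕ) (hK : DiagStronglyStable A B κ γ K) :
    imitation H A B K₀ K ∈ policySet H dx du κ κB γ := by
  intro i hi
  obtain ⟨hi1, hiH⟩ := Finset.mem_Icc.1 hi
  have := h.one_le
  have : 0 ≤ 1 - γ := sub_nonneg.2 h.lt_one.le
  rw [imitation, block_ofBlocks _ (by lia)]
  calc ‖(K₀ - K) * (A - B * K) ^ (i - 1)‖ ≤ 2 * κ ^ 3 * (1 - γ) ^ (i - 1) :=
        h.norm_imitation_le hK (i - 1)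
    _ ≤ κB * (1 - γ) * κ ^ 3 * (1 - γ) ^ (i - 1) := by
        gcongr
        exact h.two_le
    _ = κ ^ 3 * κB * (1 - γ) ^ (i - 1 + 1) := by ring
    _ = κ ^ 3 * κB * (1 - γ) ^ i := by rw [Nat.sub_add_cancel hi1]

variable {w : ℕ → Vec dx} (hw : ∀ s, ‖w s‖ ≤ W) (t : ℕ)
include hw

lemma norm_state_sub_response_le {M : Policy H dx du} (hM : M ∈ policySet H dx du κ κB γ) :
    ‖state A B (policyCtrl K₀ (fun _ => M) w) w (t + 1)
        - response (A - B * K₀) B (history w (t + 1)) M‖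
      ≤ scale κ γ κB ^ 7 * W * (1 - γ) ^ H := by
  have hW : 0 ≤ W := (norm_nonneg _).trans (hw 0)
  have hγ : 0 ≤ 1 - γ := sub_nonneg.2 h.lt_one.le
  have := h.two_le_bound
  have := h.two_le_scale
  rw [state_policyCtrl_eq_sum, response]
  calc _ ≤ κ ^ 2 * (κB * (scale κ γ κB ^ 3 * W) + W) * (1 - γ) ^ (H + 1) * γ⁻¹ :=
        norm_sum_range_sub_sum_range_le h.pos h.lt_one (by positivity)
          (h.norm_contribution_le hM (norm_history_le hw (t + 1)))
          (fun j hj => contribution_history_of_le B w (A - B * K₀) M hj) (H + 1)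
    _ = κ ^ 2 * (κB * (scale κ γ κB ^ 3 * W) + W) * γ⁻¹ * (1 - γ) ^ (H + 1) := by ring
    _ ≤ scale κ γ κB ^ 7 * W * (1 - γ) ^ H :=
        mul_le_mul (h.response_bound_le hW)
          (pow_le_pow_of_le_one hγ (by linarith [h.pos]) H.le_succ) (by positivity) (by positivity)

-- The state of the linear controller is `∑ (A - B K) ^ j w_{t-j}`; the imitating policy keeps the
-- first `H` terms of the resulting expansion of `(K₀ - K) x`.
lemma norm_linear_residual_sub_input_le (H : ℕ) (hK : DiagStronglyStable A B κ γ K) :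
    ‖app (K₀ - K) (state A B (linearCtrl K w) w (t + 1))
        - input (history w (t + 1)) (imitation H A B K₀ K)‖
      ≤ scale κ γ κB ^ 3 * W * (1 - γ) ^ H := by
  have hW : 0 ≤ W := (norm_nonneg _).trans (hw 0)
  have hγ : 0 ≤ 1 - γ := sub_nonneg.2 h.lt_one.le
  have := h.one_le
  have := h.one_le_inv
  have := h.two_le_scale
  let f (j : ℕ) : Vec du := app ((K₀ - K) * (A - B * K) ^ j) (history w (t + 1) j)
  have hlinear : app (K₀ - K) (state A B (linearCtrl K w) w (t + 1))
      = ∑ j ∈ Finset.range t, f j := by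
    rw [state_linearCtrl_eq_sum, app_sum]
    exact Finset.sum_congr rfl fun j hj => by
      simp only [f, history_add_one_of_lt w (Finset.mem_range.1 hj), mul_app]
  have himitation : input (history w (t + 1)) (imitation H A B K₀ K)
      = ∑ j ∈ Finset.range H, f j := by
    rw [input_apply]
    exact Finset.sum_congr rfl fun j hj => by
      rw [imitation, block_ofBlocks _ (Finset.mem_range.1 hj)]
  have hf (j : ℕ) : ‖f j‖ ≤ 2 * κ ^ 3 * W * (1 - γ) ^ j :=
    (norm_app_le_of_le (h.norm_imitation_le hK j) (norm_history_le hw _ _)).trans_eq (by ring)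
  have hzero (j : ℕ) (hj : t ≤ j) : f j = 0 := by
    simp only [f, history_add_one_of_le w hj, app_zero]
  rw [hlinear, himitation]
  calc _ ≤ 2 * κ ^ 3 * W * (1 - γ) ^ H * γ⁻¹ :=
        norm_sum_range_sub_sum_range_le h.pos h.lt_one (by positivity) hf hzero H
    _ = κ ^ 2 * (2 * κ * γ⁻¹) * (W * (1 - γ) ^ H) := by ring
    _ ≤ scale κ γ κB ^ 2 * scale κ γ κB * (W * (1 - γ) ^ H) := by
        gcongr
        exacts [h.le_scale, h.two_mul_mul_inv_le_scale]
    _ = scale κ γ κB ^ 3 * W * (1 - γ) ^ H := by ring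

end Truncation

end StableSystem

end System

section Surrogate

variable {H dx du : ℕ} {A : Matrix (Fin dx) (Fin dx) ℝ} {B : Matrix (Fin dx) (Fin du) ℝ}
  {K₀ : Matrix (Fin du) (Fin dx) ℝ} {κ γ κB W σ β : ℝ} {D : Measure (Vec dx)}

lemma continuous_sphericalCost (r : ℕ → ℝ) (t : ℕ) :
    Continuous fun p : Vec dx × Vec du => sphericalCost r t p.1 p.2 :=
  continuous_const.mul ((continuous_fst.norm.pow 2).add (continuous_snd.norm.pow 2))

lemma continuous_surrogateResponse (M : Policy H dx du) :
    Continuous (surrogateResponse A B K₀ M) :=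
  (continuous_response _ B M).prodMk
    ((continuous_app continuous_const (continuous_response _ B M)).neg.add (continuous_input M))

lemma surrogateResponse_congr {n n' : ℕ → Vec dx} (hn : ∀ i < 2 * H + 1, n i = n' i)
    (M : Policy H dx du) : surrogateResponse A B K₀ M n = surrogateResponse A B K₀ M n' := by
  rw [surrogateResponse, surrogateResponse, response_congr _ _ hn,
    input_congr fun i hi => hn i (by lia)]

lemma surrogateCost_eq_integral (c : Vec dx → Vec du → ℝ) (M : Policy H dx du) :
    surrogateCost A B K₀ D c M
      = ∫ n, c (surrogateResponse A B K₀ M (extend n)).1 (surrogateResponse A B K₀ M (extend n)).2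
          ∂(Measure.pi fun _ : Fin (2 * H + 1) => D) := by
  simp only [surrogateCost, surrogateState_eq, surrogateAction_eq, surrogateResponse]

lemma surrogateCost_sphericalCost (r : ℕ → ℝ) (t : ℕ) (M : Policy H dx du) :
    surrogateCost A B K₀ D (sphericalCost r t) M = r t * meanSquare A B K₀ D M :=
  integral_const_mul _ _

namespace StableSystem

variable [IsProbabilityMeasure D] (h : StableSystem A B K₀ κ γ κB) (hD : NoiseLaw D W σ)
  {M N : Policy H dx du} (hM : M ∈ policySet H dx du κ κB γ)
include h hD hM

lemma surrogateCost_mem_Icc {r : ℕ → ℝ} {t : ℕ} (hr : r t ∈ Set.Icc 0 β) :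
    surrogateCost A B K₀ D (sphericalCost r t) M
      ∈ Set.Icc 0 (β * (2 * (scale κ γ κB ^ 9 * W) ^ 2)) := by
  rw [surrogateCost_eq_integral]
  refine (convex_Icc _ _).integral_mem isClosed_Icc ?_ (hD.integrable_pi
    ((continuous_sphericalCost r t).comp
      ((continuous_surrogateResponse M).comp continuous_extend)))
  filter_upwards [hD.ae_pi_norm_le (2 * H + 1)] with n hn
  exact sphericalCost_mem_Icc hr (h.norm_surrogateResponse_le hM (norm_extend_le hD.nonneg hn))

lemma sqNorm_gram_sub_le (hN : N ∈ policySet H dx du κ κB γ) :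
    sqNorm (gram H A B K₀ D) (M - N) ≤ (3 * (scale κ γ κB ^ 9 * W)) ^ 2 := by
  let b := scale κ γ κB ^ 9 * W
  have hpoint : ∀ᵐ n ∂(Measure.pi fun _ : Fin (2 * H + 1) => D),
      tangent A B K₀ n (M - N) ⬝ᵥ tangent A B K₀ n (M - N) ∈ Set.Iic ((3 * b) ^ 2) := by
    filter_upwards [hD.ae_pi_norm_le (2 * H + 1)] with n hn
    let x := surrogateState A B K₀ M n - surrogateState A B K₀ N n
    let a := surrogateAction A B K₀ M n - surrogateAction A B K₀ N n
    have hxa : ‖(x, a)‖ ≤ 2 * b := by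
      simp only [x, a, surrogateState_eq, surrogateAction_eq]
      exact (norm_sub_le_of_le
        (h.norm_surrogateResponse_le hM (norm_extend_le hD.nonneg hn))
        (h.norm_surrogateResponse_le hN (norm_extend_le hD.nonneg hn))).trans_eq (two_mul b).symm
    have heq : tangent A B K₀ n (M - N) ⬝ᵥ tangent A B K₀ n (M - N) = ‖x‖ ^ 2 + ‖a‖ ^ 2 := by
      rw [← surrogatePair_sub_surrogatePair, ← sumElim_dotProduct_self]
      congr 1 <;> ext (i | i) <;> rfl
    have hx := pow_le_pow_left₀ (norm_nonneg x) ((norm_fst_le (x, a)).trans hxa) 2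
    have ha := pow_le_pow_left₀ (norm_nonneg a) ((norm_snd_le (x, a)).trans hxa) 2
    rw [heq, Set.mem_Iic]
    linarith [sq_nonneg b]
  rw [sqNorm_gram A B K₀ hD]
  exact (convex_Iic _).integral_mem isClosed_Iic hpoint
    (hD.integrable_pi (continuous_tangent_dotProduct_self A B K₀ _))

end StableSystem

end Surrogate

section RandomTrajectories

variable {dx du : ℕ}

section Continuity

variable {X : Type*} [TopologicalSpace X] {ctrl : X → ℕ → Vec dx → Vec du} {w : X → ℕ → Vec dx}

lemma continuous_trajectory (A : Matrix (Fin dx) (Fin dx) ℝ) (B : Matrix (Fin dx) (Fin du) ℝ)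
    (hctrl : ∀ t, Continuous fun p : X × Vec dx => ctrl p.1 t p.2) (hw : Continuous w) (t : ℕ) :
    Continuous fun x => trajectory A B (ctrl x) (w x) t := by
  have hstate : Continuous fun x => state A B (ctrl x) (w x) t := by
    induction t using Nat.twoStepInduction with
    | zero => exact continuous_const
    | one => exact continuous_const
    | more t _ ih =>
      exact ((continuous_app continuous_const ih).add (continuous_app continuous_const
        ((hctrl (t + 1)).comp (continuous_id.prodMk ih)))).add ((continuous_apply _).comp hw)
  exact hstate.prodMk ((hctrl t).comp (continuous_id.prodMk hstate))

lemma continuous_totalCost (A : Matrix (Fin dx) (Fin dx) ℝ) (B : Matrix (Fin dx) (Fin du) ℝ)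
    (r : ℕ → ℝ) (T : ℕ) (hctrl : ∀ t, Continuous fun p : X × Vec dx => ctrl p.1 t p.2)
    (hw : Continuous w) : Continuous fun x => totalCost A B r T (ctrl x) (w x) :=
  continuous_finsetSum _ fun t _ =>
    (continuous_sphericalCost r t).comp (continuous_trajectory A B hctrl hw t)

lemma continuous_residual (A : Matrix (Fin dx) (Fin dx) ℝ) (B : Matrix (Fin dx) (Fin du) ℝ)
    (K₀ : Matrix (Fin du) (Fin dx) ℝ)
    (hctrl : ∀ t, Continuous fun p : X × Vec dx => ctrl p.1 t p.2) (hw : Continuous w) (t : ℕ) :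
    Continuous fun x => residual A B K₀ (ctrl x) (w x) t :=
  (continuous_trajectory A B hctrl hw t).snd.add
    (continuous_app continuous_const (continuous_trajectory A B hctrl hw t).fst)

lemma continuous_linearCtrl (K : Matrix (Fin du) (Fin dx) ℝ) (t : ℕ) :
    Continuous fun p : (ℕ → Vec dx) × Vec dx => linearCtrl K p.1 t p.2 :=
  (continuous_app continuous_const continuous_snd).neg

lemma continuous_policyCtrl {H : ℕ} (K₀ : Matrix (Fin du) (Fin dx) ℝ) (M : ℕ → Policy H dx du)
    (t : ℕ) : Continuous fun p : (ℕ → Vec dx) × Vec dx => policyCtrl K₀ M p.1 t p.2 := by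
  simp only [policyCtrl_eq]
  exact (continuous_app continuous_const continuous_snd).neg.add
    ((continuous_input (M t)).comp ((continuous_history t).comp continuous_fst))

end Continuity

variable {Ω : Type*} [MeasurableSpace Ω] {P : Measure Ω} {D : Measure (Vec dx)} {W σ : ℝ}
  {w : ℕ → Ω → Vec dx}

section Noise

variable (hD : NoiseLaw D W σ) (hw : ∀ t, HasLaw (w t) D P)
include hD hw

lemma ae_norm_noise_le : ∀ᵐ ω ∂P, ∀ s, ‖w s ω‖ ≤ W :=
  ae_all_iff.2 fun s => ae_of_ae_map (hw s).aemeasurable ((hw s).map_eq.symm ▸ hD.bounded)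

lemma integrable_comp_noise [IsFiniteMeasure P] {f : (ℕ → Vec dx) → ℝ} (hf : Continuous f) :
    Integrable (fun ω => f fun s => w s ω) P :=
  integrable_comp_of_ae_mem_isCompact (isCompact_univ_pi fun _ => isCompact_closedBall 0 W)
    (aemeasurable_pi_iff.2 fun s => (hw s).aemeasurable)
    ((ae_norm_noise_le hD hw).mono fun _ hω s _ => mem_closedBall_zero_iff.2 (hω s)) hf

end Noise

lemma integral_history {N : ℕ} [IsProbabilityMeasure D] (hw : ∀ t, HasLaw (w t) D P)
    (hind : iIndepFun w P) {g : (ℕ → Vec dx) → ℝ}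
    (hg : ∀ n n' : ℕ → Vec dx, (∀ i < N, n i = n' i) → g n = g n') (hgc : Continuous g) {t : ℕ}
    (ht : N < t) :
    ∫ ω, g (history (fun s => w s ω) t) ∂P
      = ∫ n, g (extend n) ∂(Measure.pi fun _ : Fin N => D) := by
  have hinj : Function.Injective fun i : Fin N => t - 1 - i.1 := fun i j hij => by
    dsimp only at hij
    lia
  have hlaw : HasLaw (fun ω (i : Fin N) => w (t - 1 - i) ω) (Measure.pi fun _ => D) P :=
    (hind.precomp hinj).hasLaw_pi fun i => hw _
  rw [← hlaw.integral_comp (f := fun n => g (extend n))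
    (hgc.comp continuous_extend).aestronglyMeasurable]
  refine integral_congr_ae (Filter.Eventually.of_forall fun ω => hg _ _ fun i hi => ?_)
  rw [history, if_pos (by lia), extend, dif_pos hi]

lemma integral_le_sqrt_integral_sq [IsProbabilityMeasure P] {f : Ω → ℝ} (hf : MemLp f 2 P) :
    ∫ ω, f ω ∂P ≤ √(∫ ω, f ω ^ 2 ∂P) := by
  have hvar := variance_nonneg f P
  rw [variance_eq_sub hf, sub_nonneg] at hvar
  exact Real.le_sqrt_of_sq_le hvar

end RandomTrajectories

section Sums

lemma sum_Icc_le_of_initial_phase {f g : ℕ → ℝ} {e : ℝ} (he : 0 ≤ e) {N T : ℕ}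
    (hf : ∀ t ∈ Finset.Icc 1 T, f t ≤ (if t ≤ N then e else 0) + g t) :
    ∑ t ∈ Finset.Icc 1 T, f t ≤ N * e + ∑ t ∈ Finset.Icc 1 T, g t := by
  refine (Finset.sum_le_sum hf).trans ?_
  rw [Finset.sum_add_distrib, ← Finset.sum_filter, Finset.sum_const, nsmul_eq_mul]
  have hcard : {t ∈ Finset.Icc 1 T | t ≤ N}.card ≤ (Finset.Icc 1 N).card :=
    Finset.card_le_card fun t ht => by
      rw [Finset.mem_filter, Finset.mem_Icc] at ht
      exact Finset.mem_Icc.2 ⟨ht.1.1, ht.2⟩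
  rw [Nat.card_Icc, Nat.add_sub_cancel] at hcard
  gcongr

end Sums

section ExpectedCost

variable {H dx du T : ℕ} {A : Matrix (Fin dx) (Fin dx) ℝ} {B : Matrix (Fin dx) (Fin du) ℝ}
  {K₀ K : Matrix (Fin du) (Fin dx) ℝ} {κ γ κB W σ β : ℝ} {r : ℕ → ℝ}
  {Ω : Type*} [MeasurableSpace Ω] {P : Measure Ω} {w : ℕ → Ω → Vec dx} {D : Measure (Vec dx)}

lemma expectedCost_eq_integral (ctrl : (ℕ → Vec dx) → ℕ → Vec dx → Vec du) :
    expectedCost P A B w (sphericalCost r) T ctrl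
      = ∫ ω, totalCost A B r T (ctrl fun s => w s ω) (fun s => w s ω) ∂P :=
  rfl

namespace StableSystem

variable (h : StableSystem A B K₀ κ γ κB) (hD : NoiseLaw D W σ) (hw : ∀ t, HasLaw (w t) D P)
  (hr : ∀ t ∈ Finset.Icc 1 T, r t ∈ Set.Icc 0 β)
include h hD hw

section Attained

variable [IsFiniteMeasure P]
include hr

lemma continuousOn_expectedCost : ContinuousOn
    (fun K => expectedCost P A B w (sphericalCost r) T (linearCtrl K))
    {K | DiagStronglyStable A B κ γ K} := by
  simp only [expectedCost_eq_integral]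
  refine continuousOn_of_dominated
    (bound := fun _ => ∑ t ∈ Finset.Icc 1 T, β * (2 * (scale κ γ κB ^ 9 * W) ^ 2))
    (fun K _ => (integrable_comp_noise hD hw (continuous_totalCost A B r T
      (continuous_linearCtrl K) continuous_id')).aestronglyMeasurable)
    (fun K hK => ?_) (integrable_const _) (Filter.Eventually.of_forall fun ω => ?_)
  · filter_upwards [ae_norm_noise_le hD hw] with ω hω
    refine norm_sum_le_of_le _ fun t ht => ?_
    have hcost := sphericalCost_mem_Icc (hr t ht)
      (h.norm_trajectory_linearCtrl_le hω hK (Finset.mem_Icc.1 ht).1)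
    exact (Real.norm_of_nonneg hcost.1).trans_le hcost.2
  · exact (continuous_totalCost A B r T
      (fun _ => (continuous_app continuous_fst continuous_snd).neg) continuous_const).continuousOn

lemma exists_isLeast_expectedCost :
    ∃ K, DiagStronglyStable A B κ γ K ∧
      IsLeast ((fun K => expectedCost P A B w (sphericalCost r) T (linearCtrl K)) ''
        {K | DiagStronglyStable A B κ γ K})
        (expectedCost P A B w (sphericalCost r) T (linearCtrl K)) := by
  obtain ⟨K, hK, hmin⟩ := (isCompact_diagStronglyStable A B κ γ).exists_isMinOn
    ⟨K₀, h.stable⟩ (h.continuousOn_expectedCost hD hw hr)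
  exact ⟨K, hK, Set.mem_image_of_mem _ hK, Set.forall_mem_image.2 fun _ hL => hmin hL⟩

end Attained

variable [IsProbabilityMeasure P] [IsProbabilityMeasure D]

section Comparison

lemma expectedCost_sub_le (hβ : 0 ≤ β) (hr : ∀ t ∈ Finset.Icc 1 T, r t ∈ Set.Icc 0 β)
    {ctrl ctrl' : (ℕ → Vec dx) → ℕ → Vec dx → Vec du}
    (hc : ∀ t, Continuous fun p : (ℕ → Vec dx) × Vec dx => ctrl p.1 t p.2)
    (hc' : ∀ t, Continuous fun p : (ℕ → Vec dx) × Vec dx => ctrl' p.1 t p.2)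
    (hb : ∀ n, (∀ s, ‖n s‖ ≤ W) → ∀ t ∈ Finset.Icc 1 T,
      ‖trajectory A B (ctrl n) n t‖ ≤ scale κ γ κB ^ 9 * W)
    (hb' : ∀ n, (∀ s, ‖n s‖ ≤ W) → ∀ t ∈ Finset.Icc 1 T,
      ‖trajectory A B (ctrl' n) n t‖ ≤ scale κ γ κB ^ 9 * W) :
    expectedCost P A B w (sphericalCost r) T ctrl - expectedCost P A B w (sphericalCost r) T ctrl'
      ≤ 2 * β * scale κ γ κB ^ 14 * W * ∑ t ∈ Finset.Icc 1 T,
        ∫ ω, ‖residual A B K₀ (ctrl fun s => w s ω) (fun s => w s ω) t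
          - residual A B K₀ (ctrl' fun s => w s ω) (fun s => w s ω) t‖ ∂P := by
  have := h.two_le_scale
  have := hD.nonneg
  have hcost {c : (ℕ → Vec dx) → ℕ → Vec dx → Vec du}
      (hc : ∀ t, Continuous fun p : (ℕ → Vec dx) × Vec dx => c p.1 t p.2) :=
    integrable_comp_noise hD hw (continuous_totalCost A B r T hc continuous_id')
  have hresidual (t : ℕ) := integrable_comp_noise hD hw
    (f := fun n => ‖residual A B K₀ (ctrl n) n t - residual A B K₀ (ctrl' n) n t‖)
    ((continuous_residual A B K₀ hc continuous_id' t).sub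
      (continuous_residual A B K₀ hc' continuous_id' t)).norm
  rw [expectedCost_eq_integral, expectedCost_eq_integral, ← integral_sub (hcost hc) (hcost hc'),
    ← integral_finsetSum _ fun t _ => hresidual t, ← integral_const_mul]
  refine integral_mono_ae ((hcost hc).sub (hcost hc'))
    ((integrable_finsetSum _ fun t _ => hresidual t).const_mul _) ?_
  filter_upwards [ae_norm_noise_le hD hw] with ω hω
  exact (le_abs_self _).trans ((h.abs_totalCost_sub_le hβ (by positivity) hr
    (hb _ hω) (hb' _ hω)).trans_eq (by ring))

end Comparison

section Iterates

lemma integral_norm_input_history_le (hind : iIndepFun w P) (V : Policy H dx du) {t : ℕ}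
    (ht : 2 * H + 1 < t) :
    ∫ ω, ‖input (history (fun s => w s ω) t) V‖ ∂P
      ≤ scale κ γ κB * √(sqNorm (gram H A B K₀ D) V) := by
  have hcont : Continuous fun n : ℕ → Vec dx => ‖input (history n t) V‖ :=
    ((continuous_input V).comp (continuous_history t)).norm
  have hmem : MemLp (fun ω => ‖input (history (fun s => w s ω) t) V‖) 2 P :=
    (memLp_two_iff_integrable_sq (integrable_comp_noise hD hw hcont).aestronglyMeasurable).2
      (integrable_comp_noise hD hw (hcont.pow 2))
  have hscale : √(1 + ‖K₀‖ ^ 2) ≤ scale κ γ κB := by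
    have := h.one_le
    have := h.two_mul_le_scale
    have := h.stable.norm_le
    exact Real.sqrt_le_iff.2 ⟨by linarith, by nlinarith [norm_nonneg K₀]⟩
  calc ∫ ω, ‖input (history (fun s => w s ω) t) V‖ ∂P
      ≤ √(∫ ω, ‖input (history (fun s => w s ω) t) V‖ ^ 2 ∂P) :=
        integral_le_sqrt_integral_sq hmem
    _ = √(∫ n, ‖input (extend n) V‖ ^ 2 ∂(Measure.pi fun _ : Fin (2 * H + 1) => D)) := by
        rw [integral_history hw hind (g := fun n => ‖input n V‖ ^ 2) (fun n n' hn => by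
          rw [input_congr fun i hi => hn i (by lia)]) ((continuous_input V).norm.pow 2) ht]
    _ ≤ √((1 + ‖K₀‖ ^ 2) * sqNorm (gram H A B K₀ D) V) :=
        Real.sqrt_le_sqrt (integral_norm_input_sq_le A B K₀ hD V)
    _ = √(1 + ‖K₀‖ ^ 2) * √(sqNorm (gram H A B K₀ D) V) := Real.sqrt_mul (by positivity) _
    _ ≤ scale κ γ κB * √(sqNorm (gram H A B K₀ D) V) := by gcongr

lemma integral_norm_input_history_sub_le (hind : iIndepFun w P) {M N : Policy H dx du}
    (hM : M ∈ policySet H dx du κ κB γ) (hN : N ∈ policySet H dx du κ κB γ) (t : ℕ) :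
    ∫ ω, ‖input (history (fun s => w s ω) t) M - input (history (fun s => w s ω) t) N‖ ∂P
      ≤ (if t ≤ 2 * H + 1 then 2 * (scale κ γ κB ^ 3 * W) else 0)
        + scale κ γ κB * √(sqNorm (gram H A B K₀ D) (M - N)) := by
  have := h.two_le_scale
  split_ifs with ht
  · refine le_add_of_le_of_nonneg ?_ (by positivity)
    have hbound : ∀ᵐ ω ∂P, ‖‖input (history (fun s => w s ω) t) M
        - input (history (fun s => w s ω) t) N‖‖ ≤ 2 * (scale κ γ κB ^ 3 * W) := by
      filter_upwards [ae_norm_noise_le hD hw] with ω hω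
      rw [norm_norm, two_mul]
      exact norm_sub_le_of_le (h.norm_input_le hM (norm_history_le hω t))
        (h.norm_input_le hN (norm_history_le hω t))
    simpa using (le_abs_self _).trans (norm_integral_le_of_norm_le_const hbound)
  · simp only [← map_sub, zero_add]
    exact h.integral_norm_input_history_le hD hw hind (M - N) (not_le.1 ht)

lemma expectedCost_policyCtrl_sub_le (hβ : 0 ≤ β)
    (hr : ∀ t ∈ Finset.Icc 1 T, r t ∈ Set.Icc 0 β) (hind : iIndepFun w P)
    {M : ℕ → Policy H dx du} {N : Policy H dx du}
    (hM : ∀ t ∈ Finset.Icc 1 T, M t ∈ policySet H dx du κ κB γ)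
    (hN : N ∈ policySet H dx du κ κB γ) :
    expectedCost P A B w (sphericalCost r) T (policyCtrl K₀ M)
        - expectedCost P A B w (sphericalCost r) T (policyCtrl K₀ fun _ => N)
      ≤ 2 * β * scale κ γ κB ^ 14 * W * ((2 * H + 1) * (2 * (scale κ γ κB ^ 3 * W))
          + scale κ γ κB * ∑ t ∈ Finset.Icc 1 T, √(sqNorm (gram H A B K₀ D) (M t - N))) := by
  have := h.two_le_scale
  have := hD.nonneg
  refine (h.expectedCost_sub_le hD hw hβ hr (continuous_policyCtrl K₀ M)
    (continuous_policyCtrl K₀ fun _ => N)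
    (fun n hn t ht => h.norm_trajectory_policyCtrl_le hn (Finset.mem_Icc.1 ht).1 fun s hs =>
      hM s (Finset.Icc_subset_Icc_right (Finset.mem_Icc.1 ht).2 hs))
    (fun n hn t ht => h.norm_trajectory_policyCtrl_le hn (Finset.mem_Icc.1 ht).1
      fun _ _ => hN)).trans (mul_le_mul_of_nonneg_left ?_ (by positivity))
  simp only [residual_policyCtrl]
  refine (sum_Icc_le_of_initial_phase (by positivity) fun t ht =>
    h.integral_norm_input_history_sub_le hD hw hind (hM t ht) hN t).trans_eq ?_
  rw [← Finset.mul_sum]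
  push_cast
  rfl

end Iterates

section Imitation

lemma expectedCost_imitation_sub_le (hβ : 0 ≤ β) (hr : ∀ t ∈ Finset.Icc 1 T, r t ∈ Set.Icc 0 β)
    (hH : (1 - γ) ^ H ≤ 1 / T) (hK : DiagStronglyStable A B κ γ K) :
    expectedCost P A B w (sphericalCost r) T (policyCtrl K₀ fun _ => imitation H A B K₀ K)
        - expectedCost P A B w (sphericalCost r) T (linearCtrl K)
      ≤ 2 * β * scale κ γ κB ^ 17 * W ^ 2 := by
  have := h.two_le_scale
  have := hD.nonneg
  have hmem := h.imitation_mem H hK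
  have hstep (t : ℕ) (ht : t ∈ Finset.Icc 1 T) :
      ∫ ω, ‖residual A B K₀ (policyCtrl K₀ (fun _ => imitation H A B K₀ K) fun s => w s ω)
          (fun s => w s ω) t
        - residual A B K₀ (linearCtrl K fun s => w s ω) (fun s => w s ω) t‖ ∂P
      ≤ scale κ γ κB ^ 3 * W * (1 / T) := by
    obtain ⟨t, rfl⟩ := Nat.exists_eq_add_of_le' (Finset.mem_Icc.1 ht).1
    simp only [residual_policyCtrl, residual_linearCtrl]
    have hbound : ∀ᵐ ω ∂P, ‖‖input (history (fun s => w s ω) (t + 1)) (imitation H A B K₀ K)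
        - app (K₀ - K) (state A B (linearCtrl K fun s => w s ω) (fun s => w s ω) (t + 1))‖‖
        ≤ scale κ γ κB ^ 3 * W * (1 / T) := by
      filter_upwards [ae_norm_noise_le hD hw] with ω hω
      rw [norm_norm, norm_sub_rev]
      exact (h.norm_linear_residual_sub_input_le hω t H hK).trans
        (mul_le_mul_of_nonneg_left hH (by positivity))
    simpa using (le_abs_self _).trans (norm_integral_le_of_norm_le_const hbound)
  have hsum : ∑ t ∈ Finset.Icc 1 T, scale κ γ κB ^ 3 * W * (1 / T) ≤ scale κ γ κB ^ 3 * W := by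
    rw [Finset.sum_const, Nat.card_Icc, Nat.add_sub_cancel, nsmul_eq_mul, mul_left_comm]
    exact mul_le_of_le_one_right (by positivity) (by rw [mul_one_div]; exact div_self_le_one _)
  calc _ ≤ 2 * β * scale κ γ κB ^ 14 * W * (scale κ γ κB ^ 3 * W) :=
        (h.expectedCost_sub_le hD hw hβ hr (continuous_policyCtrl K₀ _) (continuous_linearCtrl K)
          (fun n hn t ht => h.norm_trajectory_policyCtrl_le hn (Finset.mem_Icc.1 ht).1
            fun _ _ => hmem)
          (fun n hn t ht => h.norm_trajectory_linearCtrl_le hn hK (Finset.mem_Icc.1 ht).1)).trans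
          (mul_le_mul_of_nonneg_left ((Finset.sum_le_sum hstep).trans hsum) (by positivity))
    _ = 2 * β * scale κ γ κB ^ 17 * W ^ 2 := by ring

end Imitation

section Surrogate

variable {N : Policy H dx du} (hN : N ∈ policySet H dx du κ κB γ)
include hN

omit hD hw [IsProbabilityMeasure P] [IsProbabilityMeasure D] in
lemma abs_sphericalCost_trajectory_sub_le {w : ℕ → Vec dx} (hw : ∀ s, ‖w s‖ ≤ W) {t : ℕ}
    (ht : 1 ≤ t) (hr : r t ∈ Set.Icc 0 β) :
    |sphericalCost r t (trajectory A B (policyCtrl K₀ (fun _ => N) w) w t).1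
          (trajectory A B (policyCtrl K₀ (fun _ => N) w) w t).2
        - sphericalCost r t (surrogateResponse A B K₀ N (history w t)).1
          (surrogateResponse A B K₀ N (history w t)).2|
      ≤ 2 * β * scale κ γ κB ^ 17 * W ^ 2 * (1 - γ) ^ H := by
  have hβ : 0 ≤ β := hr.1.trans hr.2
  have := h.two_le_scale
  have hW : 0 ≤ W := (norm_nonneg _).trans (hw 0)
  refine (abs_sphericalCost_sub_le hr (h.norm_trajectory_policyCtrl_le hw ht fun _ _ => hN)
    (h.norm_surrogateResponse_le hN (norm_history_le hw t))).trans ?_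
  obtain ⟨t, rfl⟩ := Nat.exists_eq_add_of_le' ht
  let x := state A B (policyCtrl K₀ (fun _ => N) w) w (t + 1)
  let y := response (A - B * K₀) B (history w (t + 1)) N
  have haction : (trajectory A B (policyCtrl K₀ (fun _ => N) w) w (t + 1)).2
      - (surrogateResponse A B K₀ N (history w (t + 1))).2 = -app K₀ (x - y) := by
    rw [trajectory, policyCtrl_eq, surrogateResponse, add_sub_add_right_eq_sub, app_sub]
    abel
  rw [haction, norm_neg]
  calc β * (2 * (scale κ γ κB ^ 9 * W)) * (‖x - y‖ + ‖app K₀ (x - y)‖)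
      ≤ β * (2 * (scale κ γ κB ^ 9 * W)) * (2 * κ * ‖x - y‖) := by
        have hfeedback := norm_app_le_of_le h.stable.norm_le (le_refl ‖x - y‖)
        gcongr
        nlinarith [h.one_le, norm_nonneg (x - y)]
    _ ≤ β * (2 * (scale κ γ κB ^ 9 * W)) *
          (scale κ γ κB * (scale κ γ κB ^ 7 * W * (1 - γ) ^ H)) := by
        gcongr
        exacts [h.two_mul_le_scale, h.norm_state_sub_response_le hw t hN]
    _ = 2 * β * scale κ γ κB ^ 17 * W ^ 2 * (1 - γ) ^ H := by ring

lemma abs_integral_sphericalCost_sub_surrogateCost_le (hind : iIndepFun w P) {t : ℕ} (ht : 1 ≤ t)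
    (hr : r t ∈ Set.Icc 0 β) :
    |∫ ω, sphericalCost r t
          (trajectory A B (policyCtrl K₀ (fun _ => N) fun s => w s ω) (fun s => w s ω) t).1
          (trajectory A B (policyCtrl K₀ (fun _ => N) fun s => w s ω) (fun s => w s ω) t).2 ∂P
        - surrogateCost A B K₀ D (sphericalCost r t) N|
      ≤ (if t ≤ 2 * H + 1 then 2 * β * scale κ γ κB ^ 18 * W ^ 2 else 0)
        + 2 * β * scale κ γ κB ^ 17 * W ^ 2 * (1 - γ) ^ H := by
  have hβ : 0 ≤ β := hr.1.trans hr.2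
  have := h.two_le_scale
  have hγ : 0 ≤ 1 - γ := sub_nonneg.2 h.lt_one.le
  let f (n : ℕ → Vec dx) : ℝ := sphericalCost r t
    (trajectory A B (policyCtrl K₀ (fun _ => N) n) n t).1
    (trajectory A B (policyCtrl K₀ (fun _ => N) n) n t).2
  let g (n : ℕ → Vec dx) : ℝ :=
    sphericalCost r t (surrogateResponse A B K₀ N n).1 (surrogateResponse A B K₀ N n).2
  have hf : Integrable (fun ω => f fun s => w s ω) P :=
    integrable_comp_noise hD hw ((continuous_sphericalCost r t).comp
      (continuous_trajectory A B (continuous_policyCtrl K₀ fun _ => N) continuous_id' t))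
  change |∫ ω, f (fun s => w s ω) ∂P - _| ≤ _
  split_ifs with hcase
  · refine le_add_of_le_of_nonneg ?_ (by positivity)
    have hmem : ∫ ω, f (fun s => w s ω) ∂P ∈ Set.Icc 0 (β * (2 * (scale κ γ κB ^ 9 * W) ^ 2)) :=
      (convex_Icc _ _).integral_mem isClosed_Icc
        ((ae_norm_noise_le hD hw).mono fun ω hω => sphericalCost_mem_Icc hr
          (h.norm_trajectory_policyCtrl_le hω ht fun _ _ => hN)) hf
    exact (Real.dist_le_of_mem_Icc hmem (h.surrogateCost_mem_Icc hD hN hr)).trans_eq (by ring)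
  · have hg : Continuous g := (continuous_sphericalCost r t).comp (continuous_surrogateResponse N)
    have hsurrogate : surrogateCost A B K₀ D (sphericalCost r t) N
        = ∫ ω, g (history (fun s => w s ω) t) ∂P := by
      rw [surrogateCost_eq_integral, integral_history hw hind (g := g)
        (fun n n' hn => by simp only [g, surrogateResponse_congr hn]) hg (not_le.1 hcase)]
    have hbound : ∀ᵐ ω ∂P, ‖f (fun s => w s ω) - g (history (fun s => w s ω) t)‖
        ≤ 2 * β * scale κ γ κB ^ 17 * W ^ 2 * (1 - γ) ^ H :=
      (ae_norm_noise_le hD hw).mono fun ω hω =>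
        h.abs_sphericalCost_trajectory_sub_le hN hω ht hr
    rw [zero_add, hsurrogate, ← integral_sub hf (integrable_comp_noise hD hw
      (f := fun n => g (history n t)) (hg.comp (continuous_history t)))]
    simpa using norm_integral_le_of_norm_le_const hbound

lemma abs_expectedCost_sub_surrogateCost_le (hr : ∀ t ∈ Finset.Icc 1 T, r t ∈ Set.Icc 0 β)
    (hβ : 0 ≤ β) (hind : iIndepFun w P) (hH : (1 - γ) ^ H ≤ 1 / T) :
    |expectedCost P A B w (sphericalCost r) T (policyCtrl K₀ fun _ => N)
        - ∑ t ∈ Finset.Icc 1 T, surrogateCost A B K₀ D (sphericalCost r t) N|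
      ≤ (2 * H + 1) * (2 * β * scale κ γ κB ^ 18 * W ^ 2)
        + 2 * β * scale κ γ κB ^ 17 * W ^ 2 := by
  have := h.two_le_scale
  simp only [expectedCost_eq_integral, totalCost]
  rw [integral_finsetSum _ fun t _ => integrable_comp_noise hD hw
    (f := fun n => sphericalCost r t (trajectory A B (policyCtrl K₀ (fun _ => N) n) n t).1
      (trajectory A B (policyCtrl K₀ (fun _ => N) n) n t).2)
    ((continuous_sphericalCost r t).comp
      (continuous_trajectory A B (continuous_policyCtrl K₀ fun _ => N) continuous_id' t)),
    ← Finset.sum_sub_distrib]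
  refine (Finset.abs_sum_le_sum_abs _ _).trans ((sum_Icc_le_of_initial_phase (by positivity)
    fun t ht => h.abs_integral_sphericalCost_sub_surrogateCost_le hD hw hN hind
      (Finset.mem_Icc.1 ht).1 (hr t ht)).trans ?_)
  push_cast
  gcongr
  rw [Finset.sum_const, Nat.card_Icc, Nat.add_sub_cancel, nsmul_eq_mul, mul_left_comm]
  exact mul_le_of_le_one_right (by positivity)
    ((mul_le_mul_of_nonneg_left hH T.cast_nonneg).trans
      (by rw [mul_one_div]; exact div_self_le_one _))

end Surrogate

end StableSystem

end ExpectedCost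

section Regret

variable {H dx du T : ℕ} {A : Matrix (Fin dx) (Fin dx) ℝ} {B : Matrix (Fin dx) (Fin du) ℝ}
  {K₀ : Matrix (Fin du) (Fin dx) ℝ} {κ γ κB W σ α β c : ℝ} {r η : ℕ → ℝ}
  {D : Measure (Vec dx)}

lemma mul_two_mul_mem_Icc {η r t : ℝ} (hα : 0 < α) (hct : 2 * (c * (β / α)) ≤ t) (ht : 0 < t)
    (hr : r ∈ Set.Icc α β) (hη : η ∈ Set.Icc (1 / (α * t)) (c / (α * t))) :
    η * (2 * r) ∈ Set.Icc (2 / t) 1 := by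
  have hη0 : 0 ≤ η := le_trans (by positivity) hη.1
  constructor
  · calc 2 / t = 1 / (α * t) * (2 * α) := by field_simp
      _ ≤ η * (2 * r) := by gcongr; exacts [hη.1, hr.1]
  · calc η * (2 * r) ≤ c / (α * t) * (2 * β) := by
          gcongr
          exacts [mul_nonneg zero_le_two (hα.le.trans hr.1), hη0.trans hη.2, hη.2, hr.2]
      _ = 2 * (c * (β / α)) / t := by field_simp
      _ ≤ 1 := (div_le_one ht).2 hct

namespace IsNaturalGradientRun

lemma mem {C : ℕ → Vec dx → Vec du → ℝ} {M : ℕ → Policy H dx du}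
    (hM : IsNaturalGradientRun A B K₀ κ κB γ D C η T M) {t : ℕ} (ht : t ∈ Finset.Icc 1 T) :
    M t ∈ policySet H dx du κ κB γ := by
  obtain ⟨ht1, htT⟩ := Finset.mem_Icc.1 ht
  obtain ⟨s, rfl⟩ := Nat.exists_eq_add_of_le' ht1
  rcases s.eq_zero_or_pos with rfl | hs
  · exact hM.1
  · exact (hM.2 s hs (by lia)).1

variable {M : ℕ → Policy H dx du}
  (hM : IsNaturalGradientRun A B K₀ κ κB γ D (sphericalCost r) η T M)
include hM

section Contraction

variable (hgram : (gram H A B K₀ D).PosDef) {m : Policy H dx du} {c₁ : ℝ}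
  (hm : ∀ V, meanSquare A B K₀ D V = c₁ + sqNorm (gram H A B K₀ D) (V - m))
include hgram hm

lemma isProjection {t : ℕ} (ht : 1 ≤ t) (htT : t < T) :
    IsProjection (gram H A B K₀ D) (policySet H dx du κ κB γ)
      (M t - (η t * (2 * r t)) • (M t - m)) (M (t + 1)) := by
  have hcost : (surrogateCost A B K₀ D (sphericalCost r t) : Policy H dx du → ℝ)
      = fun V => r t * (c₁ + sqNorm (gram H A B K₀ D) (V - m)) :=
    funext fun V => by rw [surrogateCost_sphericalCost, hm]
  have hstep := hM.2 t ht htT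
  rwa [hcost, toEuclideanLin_inv_gradient hgram, smul_smul] at hstep

variable (hα : 0 < α) (hr : ∀ t, 1 ≤ t → t ≤ T → r t ∈ Set.Icc α β)
  (hη : ∀ t : ℕ, 1 ≤ t → t < T → η t ∈ Set.Icc (1 / (α * t)) (c / (α * t)))
  {N : Policy H dx du} (hN : IsProjection (gram H A B K₀ D) (policySet H dx du κ κB γ) m N)
include hα hr hη hN

lemma mul_sqrt_sqNorm_sub_le {t : ℕ} (ht : 1 ≤ t) (htT : t < T) (hct : 2 * (c * (β / α)) ≤ t) :
    t * √(sqNorm (gram H A B K₀ D) (M (t + 1) - N))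
      ≤ (t - 2) * √(sqNorm (gram H A B K₀ D) (M t - N)) := by
  have ht0 : (0 : ℝ) < t := by exact_mod_cast ht
  obtain ⟨hs, hs1⟩ := mul_two_mul_mem_Icc hα hct ht0 (hr t ht htT.le) (hη t ht htT)
  have hcontract := sqrt_sqNorm_sub_le_of_isProjection hgram.posSemidef convex_policySet
    ((by positivity : (0 : ℝ) ≤ 2 / t).trans hs) (hM.isProjection hgram hm ht htT) hN
  rw [abs_of_nonneg (sub_nonneg.2 hs1)] at hcontract
  calc t * √(sqNorm (gram H A B K₀ D) (M (t + 1) - N))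
      ≤ t * ((1 - 2 / t) * √(sqNorm (gram H A B K₀ D) (M t - N))) := by
        gcongr
        exact hcontract.trans (by gcongr)
    _ = (t - 2) * √(sqNorm (gram H A B K₀ D) (M t - N)) := by field_simp

lemma sum_sqrt_sqNorm_sub_le [IsProbabilityMeasure D] (h : StableSystem A B K₀ κ γ κB)
    (hD : NoiseLaw D W σ) (hcβ : 1 ≤ c * (β / α)) :
    ∑ t ∈ Finset.Icc 1 T, √(sqNorm (gram H A B K₀ D) (M t - N))
      ≤ 18 * (c * (β / α)) * (scale κ γ κB ^ 9 * W) := by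
  have := h.two_le_scale
  have := hD.nonneg
  have hdiam (t : ℕ) (ht : 1 ≤ t) (htT : t ≤ T) :
      √(sqNorm (gram H A B K₀ D) (M t - N)) ≤ 3 * (scale κ γ κB ^ 9 * W) :=
    Real.sqrt_le_iff.2 ⟨by positivity,
      h.sqNorm_gram_sub_le hD (hM.mem (Finset.mem_Icc.2 ⟨ht, htT⟩)) hN.1⟩
  let k := ⌈2 * (c * (β / α))⌉₊
  have hk : 2 * (c * (β / α)) ≤ k := Nat.le_ceil _
  have hk2 : 2 ≤ k := by
    have : (2 : ℝ) ≤ k := by linarith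
    exact_mod_cast this
  have hk3 : (k : ℝ) ≤ 3 * (c * (β / α)) := by
    linarith [Nat.ceil_lt_add_one (show 0 ≤ 2 * (c * (β / α)) by linarith)]
  calc ∑ t ∈ Finset.Icc 1 T, √(sqNorm (gram H A B K₀ D) (M t - N))
      ≤ 2 * k * (3 * (scale κ γ κB ^ 9 * W)) :=
        sum_le_of_contraction (fun _ => Real.sqrt_nonneg _) (by positivity) hdiam hk2
          fun t hkt htT => hM.mul_sqrt_sqNorm_sub_le hgram hm hα hr hη hN (by lia) htT
            (hk.trans (by exact_mod_cast hkt))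
    _ ≤ 2 * (3 * (c * (β / α))) * (3 * (scale κ γ κB ^ 9 * W)) := by gcongr
    _ = 18 * (c * (β / α)) * (scale κ γ κB ^ 9 * W) := by ring

end Contraction

lemma exists_minimizer [IsProbabilityMeasure D] (h : StableSystem A B K₀ κ γ κB)
    (hD : NoiseLaw D W σ) (hσ : 0 < σ) (hα : 0 < α) (hr : ∀ t, 1 ≤ t → t ≤ T → r t ∈ Set.Icc α β)
    (hη : ∀ t : ℕ, 1 ≤ t → t < T → η t ∈ Set.Icc (1 / (α * t)) (c / (α * t)))
    (hcβ : 1 ≤ c * (β / α)) :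
    ∃ N ∈ policySet H dx du κ κB γ,
      (∀ V ∈ policySet H dx du κ κB γ, meanSquare A B K₀ D N ≤ meanSquare A B K₀ D V) ∧
      ∑ t ∈ Finset.Icc 1 T, √(sqNorm (gram H A B K₀ D) (M t - N))
        ≤ 18 * (c * (β / α)) * (scale κ γ κB ^ 9 * W) := by
  have hgram := gram_posDef (H := H) A B K₀ hD hσ
  obtain ⟨c₀, b, hquad⟩ := exists_meanSquare_eq (H := H) A B K₀ hD
  obtain ⟨m, c₁, hsquare⟩ := exists_eq_add_sqNorm_sub hgram c₀ b
  have hm V := (hquad V).trans (hsquare V)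
  obtain ⟨N, hN⟩ := exists_isProjection hgram.posSemidef isCompact_policySet ⟨M 1, hM.1⟩ m
  refine ⟨N, hN.1, fun V hV => ?_, hM.sum_sqrt_sqNorm_sub_le hgram hm hα hr hη hN h hD hcβ⟩
  rw [hm, hm]
  exact add_le_add_right (hN.2 V hV) _

end IsNaturalGradientRun

namespace StableSystem

variable {K : Matrix (Fin du) (Fin dx) ℝ} {Ω : Type*} [MeasurableSpace Ω] {P : Measure Ω}
  [IsProbabilityMeasure P] [IsProbabilityMeasure D] {w : ℕ → Ω → Vec dx}
  (h : StableSystem A B K₀ κ γ κB) (hD : NoiseLaw D W σ) (hw : ∀ t, HasLaw (w t) D P)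
  (hind : iIndepFun w P) (hH : (1 - γ) ^ H ≤ 1 / T) (hK : DiagStronglyStable A B κ γ K)
include h hD hw hind hH hK

lemma expectedCost_minimizer_sub_le (hβ : 0 ≤ β) (hr : ∀ t ∈ Finset.Icc 1 T, r t ∈ Set.Icc 0 β)
    {N : Policy H dx du} (hN : N ∈ policySet H dx du κ κB γ)
    (hmin : ∀ V ∈ policySet H dx du κ κB γ, meanSquare A B K₀ D N ≤ meanSquare A B K₀ D V) :
    expectedCost P A B w (sphericalCost r) T (policyCtrl K₀ fun _ => N)
        - expectedCost P A B w (sphericalCost r) T (linearCtrl K)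
      ≤ (2 * H + 1) * (4 * β * scale κ γ κB ^ 18 * W ^ 2) + 6 * β * scale κ γ κB ^ 17 * W ^ 2 := by
  have hI := h.imitation_mem H hK
  have hsurrogate : ∑ t ∈ Finset.Icc 1 T, surrogateCost A B K₀ D (sphericalCost r t) N
      ≤ ∑ t ∈ Finset.Icc 1 T,
          surrogateCost A B K₀ D (sphericalCost r t) (imitation H A B K₀ K) := by
    simp only [surrogateCost_sphericalCost]
    exact Finset.sum_le_sum fun t ht => mul_le_mul_of_nonneg_left (hmin _ hI) (hr t ht).1
  have hcostN := (abs_le.1 (h.abs_expectedCost_sub_surrogateCost_le hD hw hN hr hβ hind hH)).2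
  have hcostI := (abs_le.1 (h.abs_expectedCost_sub_surrogateCost_le hD hw hI hr hβ hind hH)).1
  linarith [h.expectedCost_imitation_sub_le hD hw hβ hr hH hK]

lemma regret_le (hσ : 0 < σ) (hc : 1 ≤ c) (hα : 0 < α)
    (hr : ∀ t, 1 ≤ t → t ≤ T → r t ∈ Set.Icc α β)
    (hη : ∀ t : ℕ, 1 ≤ t → t < T → η t ∈ Set.Icc (1 / (α * t)) (c / (α * t)))
    {M : ℕ → Policy H dx du}
    (hM : IsNaturalGradientRun A B K₀ κ κB γ D (sphericalCost r) η T M) (hαβ : α ≤ β) :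
    expectedCost P A B w (sphericalCost r) T (policyCtrl K₀ M)
        - expectedCost P A B w (sphericalCost r) T (linearCtrl K)
      ≤ 50 * c * (2 * H + 1) * scale κ γ κB ^ 24 * (β ^ 2 * W ^ 2 / α) := by
  have hz := h.two_le_scale
  have hW := hD.nonneg
  have hβ : 0 ≤ β := hα.le.trans hαβ
  have hr0 : ∀ t ∈ Finset.Icc 1 T, r t ∈ Set.Icc 0 β := fun t ht =>
    Set.Icc_subset_Icc_left hα.le (hr t (Finset.mem_Icc.1 ht).1 (Finset.mem_Icc.1 ht).2)
  obtain ⟨N, hN, hmin, hsum⟩ := hM.exists_minimizer h hD hσ hα hr hη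
    (one_le_mul_of_one_le_of_one_le hc ((one_le_div hα).2 hαβ))
  have hiterates := h.expectedCost_policyCtrl_sub_le hD hw hβ hr0 hind (fun t => hM.mem) hN
  have hbest := h.expectedCost_minimizer_sub_le hD hw hind hH hK hβ hr0 hN hmin
  set z := scale κ γ κB
  set n : ℝ := 2 * H + 1
  set X := β ^ 2 * W ^ 2 / α with hX
  have hβX : β * W ^ 2 ≤ X :=
    calc β * W ^ 2 = α * β * W ^ 2 / α := by field_simp
      _ ≤ β * β * W ^ 2 / α := by gcongr
      _ = X := by rw [← sq]
  have hn : 1 ≤ n := by simp [n]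
  have hcn : 1 ≤ c * n := one_le_mul_of_one_le_of_one_le hc hn
  have hncn : n ≤ c * n := le_mul_of_one_le_left (by positivity) hc
  have hlinear {j : ℕ} (hj : j ≤ 24) {a : ℝ} (ha : a ≤ c * n) :
      a * z ^ j * (β * W ^ 2) ≤ c * n * z ^ 24 * X := by
    gcongr
    linarith
  have hquadratic : c * z ^ 24 * X ≤ c * n * z ^ 24 * X := by
    gcongr
    exact le_mul_of_one_le_right (by positivity) hn
  calc _ ≤ 2 * β * z ^ 14 * W * (n * (2 * (z ^ 3 * W)) + z * (18 * (c * (β / α)) * (z ^ 9 * W)))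
        + (n * (4 * β * z ^ 18 * W ^ 2) + 6 * β * z ^ 17 * W ^ 2) := by
        rw [← sub_add_sub_cancel]
        exact add_le_add (hiterates.trans (by gcongr)) hbest
    _ = 4 * (n * z ^ 17 * (β * W ^ 2)) + 36 * (c * z ^ 24 * X)
        + 4 * (n * z ^ 18 * (β * W ^ 2)) + 6 * (1 * z ^ 17 * (β * W ^ 2)) := by
        rw [hX]; field_simp; ring
    _ ≤ 50 * c * n * z ^ 24 * X := by
        linarith [hlinear (j := 17) (by norm_num) hncn, hlinear (j := 18) (by norm_num) hncn,
          hlinear (j := 17) (by norm_num) hcn]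

end StableSystem

end Regret

section Horizon

variable {κ γ : ℝ} {T : ℕ}

lemma one_sub_pow_horizon_le (hκ : 1 ≤ κ) (hγ : 0 < γ) (hγ1 : γ < 1) (hT : 0 < T) :
    (1 - γ) ^ horizon κ γ T ≤ 1 / T := by
  have hH : Real.log (T * κ ^ 2) ≤ γ * horizon κ γ T :=
    (inv_mul_le_iff₀ hγ).1 (Nat.le_ceil _)
  calc (1 - γ) ^ horizon κ γ T ≤ Real.exp (-γ) ^ horizon κ γ T :=
        pow_le_pow_left₀ (sub_nonneg.2 hγ1.le) (Real.one_sub_le_exp_neg γ) _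
    _ = Real.exp (-(γ * horizon κ γ T)) := by rw [← Real.exp_nat_mul, mul_comm γ, mul_neg]
    _ ≤ Real.exp (-Real.log (T * κ ^ 2)) := Real.exp_le_exp.2 (neg_le_neg hH)
    _ = 1 / (T * κ ^ 2) := by rw [Real.exp_neg, Real.exp_log (by positivity), one_div]
    _ ≤ 1 / T := by
        gcongr
        exact le_mul_of_one_le_right (by positivity) (one_le_pow₀ hκ)

lemma half_le_log (hT : 2 ≤ T) : 1 / 2 ≤ Real.log T := by
  have hlog : Real.log 2 ≤ Real.log T := Real.log_le_log two_pos (by exact_mod_cast hT)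
  linarith [Real.log_two_gt_d9]

lemma StableSystem.two_mul_horizon_add_one_le {dx du : ℕ} {A : Matrix (Fin dx) (Fin dx) ℝ}
    {B : Matrix (Fin dx) (Fin du) ℝ} {K₀ : Matrix (Fin du) (Fin dx) ℝ} {κB : ℝ}
    (h : StableSystem A B K₀ κ γ κB) (hT : 2 ≤ T) :
    2 * (horizon κ γ T : ℝ) + 1 ≤ 8 * scale κ γ κB * Real.log T := by
  have hκ := h.one_le
  have hγ := h.one_le_inv
  have hz := h.two_le_scale
  have hlog := half_le_log hT
  have hlogκ : Real.log κ ≤ κ - 1 := Real.log_le_sub_one_of_pos (by linarith)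
  have hexpand : Real.log (T * κ ^ 2) = Real.log T + 2 * Real.log κ := by
    rw [Real.log_mul (by positivity) (by positivity), Real.log_pow]
    norm_cast
  have hceil : (horizon κ γ T : ℝ) ≤ γ⁻¹ * Real.log (T * κ ^ 2) + 1 := by
    refine (Nat.ceil_lt_add_one ?_).le
    rw [hexpand]
    have := Real.log_nonneg hκ
    positivity
  have hsum : Real.log T + 2 * Real.log κ ≤ 4 * κ * Real.log T := by nlinarith
  have hmain : γ⁻¹ * Real.log (T * κ ^ 2) ≤ 2 * scale κ γ κB * Real.log T :=
    calc γ⁻¹ * Real.log (T * κ ^ 2) ≤ γ⁻¹ * (4 * κ * Real.log T) := by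
          rw [hexpand]
          gcongr
      _ = 2 * (2 * κ * γ⁻¹) * Real.log T := by ring
      _ ≤ 2 * scale κ γ κB * Real.log T := by
          gcongr
          exact h.two_mul_mul_inv_le_scale
  have hone : 1 ≤ scale κ γ κB * Real.log T := by nlinarith
  linarith

end Horizon

section Dimension

variable {dx du : ℕ}

-- In dimension `0` the noise vanishes, so that the factor `dx` is harmless there.
lemma NoiseLaw.dim_mul {D : Measure (Vec dx)} {W σ : ℝ} (hD : NoiseLaw D W σ) :
    NoiseLaw D (dx * W) σ where
  bounded := hD.bounded.mono fun x hx => by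
    rcases dx.eq_zero_or_pos with rfl | hdx
    · simp [Subsingleton.elim x 0]
    · exact hx.trans (le_mul_of_one_le_left ((norm_nonneg x).trans hx) (by exact_mod_cast hdx))
  centred := hD.centred
  covariance := hD.covariance

lemma sq_le_max_pow (m n : ℕ) {p : ℕ} (hp : 2 ≤ p) : (m : ℝ) ^ 2 ≤ (max m n : ℕ) ^ p := by
  rcases m.eq_zero_or_pos with rfl | hm
  · simp only [Nat.cast_zero, zero_pow two_ne_zero]
    positivity
  · exact_mod_cast (Nat.pow_le_pow_right hm hp).trans (Nat.pow_le_pow_left (le_max_left m n) p)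

lemma StableSystem.horizon_mul_scale_pow_mul_le {A : Matrix (Fin dx) (Fin dx) ℝ}
    {B : Matrix (Fin dx) (Fin du) ℝ} {K₀ : Matrix (Fin du) (Fin dx) ℝ} {κ γ κB : ℝ}
    (h : StableSystem A B K₀ κ γ κB) {T : ℕ} (hT : 2 ≤ T) :
    (2 * (horizon κ γ T : ℝ) + 1) * scale κ γ κB ^ 24 * dx ^ 2
      ≤ 512 * ((max dx du : ℕ) * κ * κB * γ⁻¹) ^ 25 * Real.log T ^ 7 := by
  have := h.two_le_scale
  have hlog := half_le_log hT
  have hpow : Real.log T ≤ 64 * Real.log T ^ 7 :=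
    calc Real.log T = 64 * (1 / 2) ^ 6 * Real.log T := by ring
      _ ≤ 64 * Real.log T ^ 6 * Real.log T := by gcongr
      _ = 64 * Real.log T ^ 7 := by ring
  calc (2 * (horizon κ γ T : ℝ) + 1) * scale κ γ κB ^ 24 * dx ^ 2
      ≤ 8 * scale κ γ κB * (64 * Real.log T ^ 7) * scale κ γ κB ^ 24 * (max dx du : ℕ) ^ 25 := by
        gcongr
        · exact (h.two_mul_horizon_add_one_le hT).trans (by gcongr)
        · exact sq_le_max_pow dx du (by norm_num)
    _ = 512 * ((max dx du : ℕ) * κ * κB * γ⁻¹) ^ 25 * Real.log T ^ 7 := by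
        rw [scale]
        ring

end Dimension

end

end OnlineControl

theorem corollary2_general {dx du H T : ℕ}
    {A : Matrix (Fin dx) (Fin dx) ℝ} {B : Matrix (Fin dx) (Fin du) ℝ}
    {K₀ : Matrix (Fin du) (Fin dx) ℝ} {κ γ κB W σ α β c : ℝ}
    {Ω : Type*} [MeasurableSpace Ω] {P : Measure Ω} [IsProbabilityMeasure P]
    {w : ℕ → Ω → Vec dx} {D : Measure (Vec dx)} {r η : ℕ → ℝ} {M : ℕ → Policy H dx du}
    (hc : 1 ≤ c) (h : StableSystem A B K₀ κ γ κB) (hσ : 0 < σ) (hD : NoiseLaw D W σ)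
    (hw : ∀ t, HasLaw (w t) D P) (hind : iIndepFun w P) (hα : 0 < α)
    (hH : (1 - γ) ^ H ≤ 1 / T) (hr : ∀ t, 1 ≤ t → t ≤ T → r t ∈ Set.Icc α β)
    (hη : ∀ t : ℕ, 1 ≤ t → t < T → η t ∈ Set.Icc (1 / (α * t)) (c / (α * t)))
    (hM : IsNaturalGradientRun A B K₀ κ κB γ D (sphericalCost r) η T M) :
    ∃ m : ℝ,
      IsLeast ((fun K => expectedCost P A B w (sphericalCost r) T (linearCtrl K)) ''
        {K | DiagStronglyStable A B κ γ K}) m ∧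
      expectedCost P A B w (sphericalCost r) T (policyCtrl K₀ M) - m ≤
        50 * c * (2 * H + 1) * scale κ γ κB ^ 24 * (β ^ 2 * W ^ 2 / α) := by
  have : IsProbabilityMeasure D := (hw 0).isProbabilityMeasure_iff.1 ‹_›
  have hT : 1 ≤ T := by
    rw [Nat.one_le_iff_ne_zero]
    rintro rfl
    rw [Nat.cast_zero, div_zero] at hH
    exact hH.not_gt (pow_pos (sub_pos.2 h.lt_one) H)
  have hαβ : α ≤ β := (hr 1 le_rfl hT).1.trans (hr 1 le_rfl hT).2
  obtain ⟨K, hK, hleast⟩ := h.exists_isLeast_expectedCost (T := T) (r := r) (β := β) hD hw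
    fun t ht => Set.Icc_subset_Icc_left hα.le
      (hr t (Finset.mem_Icc.1 ht).1 (Finset.mem_Icc.1 ht).2)
  exact ⟨_, hleast, h.regret_le hD hw hind hH hK hσ hc hα hr hη hM hαβ⟩

theorem corollary2 (c : ℝ) (hc : 1 ≤ c) :
    ∃ (C : ℝ) (p : ℕ), ∀ (dx du : ℕ)
      (A : Matrix (Fin dx) (Fin dx) ℝ) (B : Matrix (Fin dx) (Fin du) ℝ)
      (K₀ : Matrix (Fin du) (Fin dx) ℝ) (κ γ κB W σ α β : ℝ)
      (Ω : Type*) [MeasurableSpace Ω] (P : Measure Ω) [IsProbabilityMeasure P]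
      (w : ℕ → Ω → Vec dx) (D : Measure (Vec dx)) (T : ℕ) (r η : ℕ → ℝ)
      (M : ℕ → Policy (horizon κ γ T) dx du),
      1 ≤ κ → 0 < γ → γ < 1 → ‖B‖ ≤ κB → 2 ≤ κB * (1 - γ) →
      DiagStronglyStable A B κ γ K₀ →
      0 < σ → NoiseLaw D W σ → (∀ t, HasLaw (w t) D P) → iIndepFun w P →
      0 < α → 2 ≤ T → (∀ t, 1 ≤ t → t ≤ T → r t ∈ Set.Icc α β) →
      (∀ t, 1 ≤ t → t < T → η t ∈ Set.Icc (1 / (α * t)) (c / (α * t))) →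
      IsNaturalGradientRun A B K₀ κ κB γ D (sphericalCost r) η T M →
      ∃ m : ℝ,
        IsLeast ((fun K => expectedCost P A B w (sphericalCost r) T (linearCtrl K)) ''
          {K | DiagStronglyStable A B κ γ K}) m ∧
        expectedCost P A B w (sphericalCost r) T (policyCtrl K₀ M) - m ≤
          C * ((max dx du : ℕ) * κ * κB * γ⁻¹) ^ p * (β ^ 2 * W ^ 2 / α) * Real.log T ^ 7 := by
  refine ⟨50 * c * 512, 25, ?_⟩
  intro dx du A B K₀ κ γ κB W σ α β Ω _ P _ w D T r η M hκ hγ hγ1 hB hκB hK₀ hσ hD hw hind hα hT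
    hr hη hM
  have h : StableSystem A B K₀ κ γ κB := ⟨hκ, hγ, hγ1, hB, hκB, hK₀⟩
  obtain ⟨m, hm, hregret⟩ := corollary2_general hc h hσ hD.dim_mul hw hind hα
    (one_sub_pow_horizon_le hκ hγ hγ1 (by lia)) hr hη hM
  refine ⟨m, hm, hregret.trans ?_⟩
  calc 50 * c * (2 * (horizon κ γ T : ℝ) + 1) * scale κ γ κB ^ 24 * (β ^ 2 * (dx * W) ^ 2 / α)
      = 50 * c * ((2 * (horizon κ γ T : ℝ) + 1) * scale κ γ κB ^ 24 * dx ^ 2)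
          * (β ^ 2 * W ^ 2 / α) := by ring
    _ ≤ 50 * c * (512 * ((max dx du : ℕ) * κ * κB * γ⁻¹) ^ 25 * Real.log T ^ 7)
          * (β ^ 2 * W ^ 2 / α) :=
        mul_le_mul_of_nonneg_right
          (mul_le_mul_of_nonneg_left (h.horizon_mul_scale_pow_mul_le hT) (by positivity))
          (by positivity)
    _ = _ := by ring
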